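/- Let $k$ be an algebraically closed field (of any characteristic) and let $H$ be a finite-dimensional Hopf algebra over $k$ with comultiplication $\Delta$, counit $\varepsilon$ and antipode $S$; we write $\Delta(h)=h_{(1)}\otimes h_{(2)}$. A coalgebra is *cosemisimple* if it is the sum of its simple subcoalgebras. $H$ is *unimodular* if its left integrals (the $t\in H$ with $ht=\varepsilon(h)t$ for all $h\in H$) coincide with its right integrals (the $t\in H$ with $th=\varepsilon(h)t$ for all $h\in H$). A *twist* for $H$ is an invertible element $J\in H\otimes H$ such that $$(\Delta\otimes \mathrm{id})(J)\,(J\otimes 1)=(\mathrm{id}\otimes\Delta)(J)\,(1\otimes J),\qquad (\varepsilon\otimes\mathrm{id})(J)=(\mathrm{id}\otimes\varepsilon)(J)=1 .$$ Write $J=J^{(1)}\otimes J^{(2)}$ and $J^{-1}=J^{-(1)}\otimes J^{-(2)}$ (sums understood), $Q_J=S(J^{(1)})J^{(2)}$ and $Q_J^{-1}=J^{-(1)}S(J^{-(2)})$. For twists $L,J$ let $H^{(L,J)}$ be the coalgebra with underlying space $H$, comultiplication $\tilde\Delta(h)=L^{-1}\Delta(h)J$ and counit $\varepsilon$. A *coseparability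 pairing* for a coalgebra $C$ (with comultiplication $c\mapsto c_{(1)}\otimes c_{(2)}$ and counit $\varepsilon$) is a linear map $\psi:C\otimes C\to k$ with $c_{(1)}\psi(c_{(2)}\otimes d)=\psi(c\otimes d_{(1)})d_{(2)}$ and $\psi(c_{(1)}\otimes c_{(2)})=\varepsilon(c)$ for all $c,d\in C$. Suppose that $H$ is cosemisimple. Then: 1. There is a left integral $\lambda\in H^*$ on $H$, i.e. $h_{(1)}\lambda(h_{(2)})=\lambda(h)1$ for all $h\in H$, with $\lambda(1)=1$. 2. If $H$ is unimodular, then for all twists $L,J$ for $H$ the coalgebra $H^{(L,J)}$ is cosemisimple; moreover, for every left integral $\lambda$ on $H$ with $\lambda(1)=1$, $$\psi(h\otimes g)=\lambda\bigl(h\,Q_J^{-1}\,S(g)\,S(Q_L)\bigr)$$ defines a coseparability pairing for $H^{(L,J)}$. 3. When $L=1\otimes 1$ is the trivial twist, the unimodularity hypothesis is not needed: for every twist $J$ for $H$ the coalgebra $H^{(1,J)}$ is cosemisimple, and the same $\psi$ (with $L=1$) is a coseparability pairing for it. -/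

import Mathlib

open scoped TensorProduct

namespace HopfTwist

section Coalgebras

variable (k : Type*) [Field k] {C : Type*} [AddCommGroup C] [Module k C] [Coalgebra k C]

/-- A subspace `D` of a coalgebra `C` is a subcoalgebra if `Δ(D) ⊆ D ⊗ D`. -/
def IsSubcoalgebra (D : Submodule k C) : Prop :=
  ∀ c ∈ D, Coalgebra.comul (R := k) c ∈ LinearMap.range (TensorProduct.mapIncl D D)

/-- A simple subcoalgebra: nonzero, and with no subcoalgebras besides `0` and itself. -/
def IsSimpleSubcoalgebra (D : Submodule k C) : Prop :=
  IsSubcoalgebra k D ∧ D ≠ ⊥ ∧ ∀ E : Submodule k C, E ≤ D → IsSubcoalgebra k E → E = ⊥ ∨ E = D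

variable (C) in
/-- The coradical of `C`: the sum of all simple subcoalgebras. -/
def coradical : Submodule k C := sSup {D : Submodule k C | IsSimpleSubcoalgebra k D}

variable (C) in
/-- A coalgebra is cosemisimple if it is the sum of its simple subcoalgebras. -/
def IsCosemisimple : Prop := coradical k C = ⊤

/-- `ψ : C ⊗ C → k` is a coseparability pairing:
`c₍₁₎ ψ(c₍₂₎ ⊗ d) = ψ(c ⊗ d₍₁₎) d₍₂₎` for all `c, d`, and `ψ(Δ(c)) = ε(c)` for all `c`. -/
def IsCoseparabilityPairing (ψ : C ⊗[k] C →ₗ[k] k) : Prop :=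
  (∀ c d : C,
    TensorProduct.rid k C (ψ.lTensor C
      (TensorProduct.assoc k C C C (Coalgebra.comul (R := k) c ⊗ₜ[k] d))) =
    TensorProduct.lid k C (ψ.rTensor C
      ((TensorProduct.assoc k C C C).symm (c ⊗ₜ[k] Coalgebra.comul (R := k) d)))) ∧
  ∀ c : C, ψ (Coalgebra.comul (R := k) c) = Coalgebra.counit (R := k) c

end Coalgebras

section HopfAlgebras

variable (k : Type*) [Field k] (H : Type*) [Ring H] [HopfAlgebra k H]

/-- `H` is unimodular: its left integrals `t` (those with `h t = ε(h) t` for all `h`) and its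
right integrals (those with `t h = ε(h) t` for all `h`) are the same elements. -/
def IsUnimodular : Prop :=
  ∀ t : H, (∀ h : H, h * t = Coalgebra.counit (R := k) h • t) ↔
    (∀ h : H, t * h = Coalgebra.counit (R := k) h • t)

variable {k H} in
/-- A linear form `lam` is a left integral on `H`: `h₍₁₎ lam(h₍₂₎) = lam(h) 1` for all `h`. -/
def IsLeftIntegralOn (lam : H →ₗ[k] k) : Prop :=
  ∀ h : H, TensorProduct.rid k H (lam.lTensor H (Coalgebra.comul (R := k) h)) = lam h • (1 : H)

/-- A (normalized) twist for `H`: an invertible `J ∈ H ⊗ H` with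
`(Δ ⊗ id)(J) (J ⊗ 1) = (id ⊗ Δ)(J) (1 ⊗ J)` and `(ε ⊗ id)(J) = (id ⊗ ε)(J) = 1`. -/
structure Twist where
  /-- the invertible element of `H ⊗ H` -/
  elt : (H ⊗[k] H)ˣ
  twist_eq :
    TensorProduct.assoc k H H H
      ((Coalgebra.comul (R := k) (A := H)).rTensor H (elt : H ⊗[k] H) *
        ((elt : H ⊗[k] H) ⊗ₜ[k] (1 : H))) =
    (Coalgebra.comul (R := k) (A := H)).lTensor H (elt : H ⊗[k] H) *
      ((1 : H) ⊗ₜ[k] (elt : H ⊗[k] H))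
  counit_left : TensorProduct.lid k H
    ((Coalgebra.counit (R := k) (A := H)).rTensor H (elt : H ⊗[k] H)) = 1
  counit_right : TensorProduct.rid k H
    ((Coalgebra.counit (R := k) (A := H)).lTensor H (elt : H ⊗[k] H)) = 1

variable {k H}

/-- The trivial twist `1 ⊗ 1`. -/
instance : One (Twist k H) where
  one :=
    { elt := 1
      twist_eq := by
        simp [Algebra.TensorProduct.one_def]
      counit_left := by simp [Algebra.TensorProduct.one_def]
      counit_right := by simp [Algebra.TensorProduct.one_def] }

/-- The linear map `h ↦ L⁻¹ Δ(h) J`. -/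
noncomputable def twistedComul (L J : Twist k H) : H →ₗ[k] H ⊗[k] H :=
  LinearMap.mulLeft k ((L.elt⁻¹ : (H ⊗[k] H)ˣ) : H ⊗[k] H) ∘ₗ
    LinearMap.mulRight k (J.elt : H ⊗[k] H) ∘ₗ Coalgebra.comul

theorem twistedComul_apply (L J : Twist k H) (h : H) :
    twistedComul L J h =
      ((L.elt⁻¹ : (H ⊗[k] H)ˣ) : H ⊗[k] H) * (Coalgebra.comul (R := k) h * J.elt) := rfl

theorem rTensor_twistedComul (L J : Twist k H) (x : H ⊗[k] H) :
    (twistedComul L J).rTensor H x =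
      (((L.elt⁻¹ : (H ⊗[k] H)ˣ) : H ⊗[k] H) ⊗ₜ[k] (1 : H)) *
        ((Coalgebra.comul (R := k) (A := H)).rTensor H x * ((J.elt : H ⊗[k] H) ⊗ₜ[k] (1 : H))) := by
  induction x with
  | zero => simp
  | tmul a b => simp [twistedComul_apply]
  | add x y hx hy => simp [hx, hy, mul_add, add_mul]

theorem lTensor_twistedComul (L J : Twist k H) (x : H ⊗[k] H) :
    (twistedComul L J).lTensor H x =
      ((1 : H) ⊗ₜ[k] ((L.elt⁻¹ : (H ⊗[k] H)ˣ) : H ⊗[k] H)) *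
        ((Coalgebra.comul (R := k) (A := H)).lTensor H x * ((1 : H) ⊗ₜ[k] (J.elt : H ⊗[k] H))) := by
  induction x with
  | zero => simp
  | tmul a b => simp [twistedComul_apply]
  | add x y hx hy => simp [hx, hy, mul_add, add_mul]

theorem rTensor_comul_mul (x y : H ⊗[k] H) :
    (Coalgebra.comul (R := k) (A := H)).rTensor H (x * y) =
      (Coalgebra.comul (R := k) (A := H)).rTensor H x *
        (Coalgebra.comul (R := k) (A := H)).rTensor H y :=
  map_mul (Algebra.TensorProduct.map (Bialgebra.comulAlgHom k H) (AlgHom.id k H)) x y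

theorem lTensor_comul_mul (x y : H ⊗[k] H) :
    (Coalgebra.comul (R := k) (A := H)).lTensor H (x * y) =
      (Coalgebra.comul (R := k) (A := H)).lTensor H x *
        (Coalgebra.comul (R := k) (A := H)).lTensor H y :=
  map_mul (Algebra.TensorProduct.map (AlgHom.id k H) (Bialgebra.comulAlgHom k H)) x y

theorem assoc_mul (x y : (H ⊗[k] H) ⊗[k] H) :
    TensorProduct.assoc k H H H (x * y) =
      TensorProduct.assoc k H H H x * TensorProduct.assoc k H H H y :=
  map_mul (Algebra.TensorProduct.assoc k k k H H H) x y

theorem assoc_one : TensorProduct.assoc k H H H (1 : (H ⊗[k] H) ⊗[k] H) = 1 := rfl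

theorem rTensor_comul_one :
    (Coalgebra.comul (R := k) (A := H)).rTensor H (1 : H ⊗[k] H) = 1 := by
  simp [Algebra.TensorProduct.one_def]

theorem lTensor_comul_one :
    (Coalgebra.comul (R := k) (A := H)).lTensor H (1 : H ⊗[k] H) = 1 := by
  simp [Algebra.TensorProduct.one_def]

/-- The inverse form of the twist equation. -/
theorem Twist.inv_twist_eq (L : Twist k H) :
    TensorProduct.assoc k H H H
      ((((L.elt⁻¹ : (H ⊗[k] H)ˣ) : H ⊗[k] H) ⊗ₜ[k] (1 : H)) *
        (Coalgebra.comul (R := k) (A := H)).rTensor H ((L.elt⁻¹ : (H ⊗[k] H)ˣ) : H ⊗[k] H)) =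
    ((1 : H) ⊗ₜ[k] ((L.elt⁻¹ : (H ⊗[k] H)ˣ) : H ⊗[k] H)) *
      (Coalgebra.comul (R := k) (A := H)).lTensor H ((L.elt⁻¹ : (H ⊗[k] H)ˣ) : H ⊗[k] H) := by
  refine left_inv_eq_right_inv (a := TensorProduct.assoc k H H H
      ((Coalgebra.comul (R := k) (A := H)).rTensor H (L.elt : H ⊗[k] H) *
        ((L.elt : H ⊗[k] H) ⊗ₜ[k] (1 : H)))) ?_ ?_
  · rw [← assoc_mul, ← assoc_one]
    congr 1
    rw [mul_assoc, ← mul_assoc (LinearMap.rTensor _ _ _) (LinearMap.rTensor _ _ _),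
      ← rTensor_comul_mul, Units.inv_mul, rTensor_comul_one, one_mul,
      Algebra.TensorProduct.tmul_mul_tmul, Units.inv_mul, one_mul]
    rfl
  · rw [L.twist_eq, mul_assoc, ← mul_assoc ((1 : H) ⊗ₜ[k] _) ((1 : H) ⊗ₜ[k] _),
      Algebra.TensorProduct.tmul_mul_tmul, Units.mul_inv, one_mul,
      ← Algebra.TensorProduct.one_def, one_mul, ← lTensor_comul_mul, Units.mul_inv,
      lTensor_comul_one]

theorem twistedComul_coassoc (L J : Twist k H) (h : H) :
    TensorProduct.assoc k H H H ((twistedComul L J).rTensor H (twistedComul L J h)) =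
      (twistedComul L J).lTensor H (twistedComul L J h) := by
  rw [rTensor_twistedComul, lTensor_twistedComul, twistedComul_apply,
    rTensor_comul_mul, rTensor_comul_mul, lTensor_comul_mul, lTensor_comul_mul,
    mul_assoc, mul_assoc, ← mul_assoc (_ ⊗ₜ[k] (1 : H)), assoc_mul, L.inv_twist_eq, assoc_mul,
    J.twist_eq, Coalgebra.coassoc_apply]
  simp only [mul_assoc]

/-- `(ε ⊗ id)` as an algebra map `H ⊗ H → H`. -/
noncomputable def counitLeft : H ⊗[k] H →ₐ[k] H :=
  (Algebra.TensorProduct.lid k H).toAlgHom.comp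
    (Algebra.TensorProduct.map (Bialgebra.counitAlgHom k H) (AlgHom.id k H))

/-- `(id ⊗ ε)` as an algebra map `H ⊗ H → H`. -/
noncomputable def counitRight : H ⊗[k] H →ₐ[k] H :=
  (Algebra.TensorProduct.rid k k H).toAlgHom.comp
    (Algebra.TensorProduct.map (AlgHom.id k H) (Bialgebra.counitAlgHom k H))

theorem counitLeft_apply (x : H ⊗[k] H) : counitLeft x =
    TensorProduct.lid k H ((Coalgebra.counit (R := k) (A := H)).rTensor H x) := rfl

theorem counitRight_apply (x : H ⊗[k] H) : counitRight x =
    TensorProduct.rid k H ((Coalgebra.counit (R := k) (A := H)).lTensor H x) := rfl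

theorem Twist.counitLeft_inv (L : Twist k H) :
    counitLeft (((L.elt⁻¹ : (H ⊗[k] H)ˣ) : H ⊗[k] H)) = 1 := by
  have h1 : counitLeft (L.elt : H ⊗[k] H) = 1 := L.counit_left
  have h2 := congrArg counitLeft L.elt.inv_mul
  rwa [map_mul, h1, mul_one, map_one] at h2

theorem Twist.counitRight_inv (L : Twist k H) :
    counitRight (((L.elt⁻¹ : (H ⊗[k] H)ˣ) : H ⊗[k] H)) = 1 := by
  have h1 : counitRight (L.elt : H ⊗[k] H) = 1 := L.counit_right
  have h2 := congrArg counitRight L.elt.inv_mul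
  rwa [map_mul, h1, mul_one, map_one] at h2

theorem counitLeft_twistedComul (L J : Twist k H) (h : H) :
    counitLeft (twistedComul L J h) = h := by
  have h1 : counitLeft (J.elt : H ⊗[k] H) = 1 := J.counit_left
  rw [twistedComul_apply, map_mul, map_mul, L.counitLeft_inv, h1, one_mul, mul_one,
    counitLeft_apply, Coalgebra.rTensor_counit_comul]
  simp

theorem counitRight_twistedComul (L J : Twist k H) (h : H) :
    counitRight (twistedComul L J h) = h := by
  have h1 : counitRight (J.elt : H ⊗[k] H) = 1 := J.counit_right
  rw [twistedComul_apply, map_mul, map_mul, L.counitRight_inv, h1, one_mul, mul_one,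
    counitRight_apply, Coalgebra.lTensor_counit_comul]
  simp

/-- The underlying space of the two-sided twisted coalgebra `H^(L,J)`: a copy of `H`. -/
def TwistedCoalgebra (_L _J : Twist k H) : Type _ := H

noncomputable instance (L J : Twist k H) : AddCommGroup (TwistedCoalgebra L J) :=
  inferInstanceAs (AddCommGroup H)

noncomputable instance (L J : Twist k H) : Module k (TwistedCoalgebra L J) :=
  inferInstanceAs (Module k H)

/-- The coalgebra `H^(L,J)`: comultiplication `h ↦ L⁻¹ Δ(h) J` and the counit of `H`. -/
noncomputable instance (L J : Twist k H) : Coalgebra k (TwistedCoalgebra L J) where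
  comul := (twistedComul L J : H →ₗ[k] H ⊗[k] H)
  counit := (Coalgebra.counit : H →ₗ[k] k)
  coassoc := LinearMap.ext (twistedComul_coassoc L J)
  rTensor_counit_comp_comul := by
    refine LinearMap.ext fun h => (TensorProduct.lid k H).injective ?_
    refine (counitLeft_twistedComul L J h).trans ?_
    exact ((TensorProduct.lid_tmul (R := k) (M := H) h 1).trans (one_smul k h)).symm
  lTensor_counit_comp_comul := by
    refine LinearMap.ext fun h => (TensorProduct.rid k H).injective ?_
    refine (counitRight_twistedComul L J h).trans ?_
    exact ((TensorProduct.rid_tmul (R := k) (M := H) h 1).trans (one_smul k h)).symm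

/-- `Q_J = S(J⁽¹⁾) J⁽²⁾`. -/
noncomputable def Twist.Q (J : Twist k H) : H :=
  LinearMap.mul' k H ((HopfAlgebra.antipode k (A := H)).rTensor H (J.elt : H ⊗[k] H))

/-- `Q_J⁻¹ = J⁻⁽¹⁾ S(J⁻⁽²⁾)`. -/
noncomputable def Twist.Qinv (J : Twist k H) : H :=
  LinearMap.mul' k H ((HopfAlgebra.antipode k (A := H)).lTensor H
    ((J.elt⁻¹ : (H ⊗[k] H)ˣ) : H ⊗[k] H))

/-- The bilinear form `ψ(h ⊗ g) = lam(h Q_J⁻¹ S(g) S(Q_L))` on `H^(L,J)`. -/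
noncomputable def twistedPairing (L J : Twist k H) (lam : H →ₗ[k] k) :
    TwistedCoalgebra L J ⊗[k] TwistedCoalgebra L J →ₗ[k] k :=
  (lam ∘ₗ LinearMap.mulRight k (HopfAlgebra.antipode k L.Q) ∘ₗ LinearMap.mul' k H ∘ₗ
    TensorProduct.map (LinearMap.mulRight k J.Qinv) (HopfAlgebra.antipode k (A := H)) :
    H ⊗[k] H →ₗ[k] k)

theorem twistedPairing_tmul (L J : Twist k H) (lam : H →ₗ[k] k) (h g : H) :
    twistedPairing L J lam
        ((show TwistedCoalgebra L J from h) ⊗ₜ[k] (show TwistedCoalgebra L J from g)) =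
      lam (h * J.Qinv * HopfAlgebra.antipode k g * HopfAlgebra.antipode k L.Q) := rfl

end HopfAlgebras

end HopfTwist

/-! A coseparability pairing `ψ` on `C` splits every subcoalgebra `D`: if `p` projects `C` linearly
onto `D`, then `c ↦ ψ(c₁ ⊗ p(c₂))` is a central idempotent of the dual algebra whose action projects
`C` onto `D` along another subcoalgebra (`IsCoseparabilityPairing.exists_isCompl`). In finite
dimension this forces cosemisimplicity, so everything reduces to producing `λ` and checking `ψ`.

In a cosemisimple `H`, the subcoalgebras avoiding `1` add up to a complement of the simple
subcoalgebra `k1`. The projection to `k1` is a normalized integral on both sides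
(`exists_twoSided_integral`), and every normalized left integral equals it.

A left integral satisfies `x₁ λ(x₂ S(d)) = λ(x S(d₁)) d₂`. Replacing `x ⊗ d` by `c J⁻⁽¹⁾ ⊗ d J⁻⁽²⁾`
and simplifying by the twist equation gives the coseparability identity for `L = 1`; left invariance
alone is used. For general `L`, a factor `L⁻⁽²⁾` stands leftmost under `λ` and has to be carried to
the right. This needs `λ(yx) = λ(x S²(y))` (`IsLeftIntegralOn.apply_mul_comm`), the only place where
unimodularity enters. The identities `(S(L⁽²⁾) ⊗ S(L⁽¹⁾)) Δ(Q_L) = (Q_L ⊗ Q_L) L⁻¹` and `Q_L⁻¹ Q_L =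
1` then finish the rearrangement.

For the normalization, let `H ⊗ H` act on `H` by `(a ⊗ b) · q = a q S(b)`: then `J` sends `Q_J⁻¹` to
`1`, `Δ(h)` sends `1` to `ε(h)1`, and `L⁻¹` sends `1` to `Q_L⁻¹`. -/

namespace HopfTwist

/-! ### Coseparable coalgebras: complements of subcoalgebras and cosemisimplicity. -/

section CoseparableCoalgebras

open Coalgebra

variable {k : Type*} [Field k] {C : Type*} [AddCommGroup C] [Module k C]

theorem lid_rTensor_mapIncl_mem (f : C →ₗ[k] k) (D : Submodule k C) (t : D ⊗[k] D) :
    TensorProduct.lid k C (f.rTensor C (TensorProduct.mapIncl D D t)) ∈ D := by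
  induction t with
  | zero => simp
  | tmul a b => simpa [TensorProduct.mapIncl] using D.smul_mem _ b.2
  | add x y hx hy => simpa using D.add_mem hx hy

theorem rid_lTensor_mapIncl_mem (f : C →ₗ[k] k) (D : Submodule k C) (t : D ⊗[k] D) :
    TensorProduct.rid k C (f.lTensor C (TensorProduct.mapIncl D D t)) ∈ D := by
  induction t with
  | zero => simp
  | tmul a b => simpa [TensorProduct.mapIncl] using D.smul_mem _ a.2
  | add x y hx hy => simpa using D.add_mem hx hy

theorem lTensor_mapIncl_congr {f g : C →ₗ[k] k} {D : Submodule k C} (h : ∀ c ∈ D, f c = g c)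
    (t : D ⊗[k] D) :
    f.lTensor C (TensorProduct.mapIncl D D t) = g.lTensor C (TensorProduct.mapIncl D D t) := by
  induction t with
  | zero => simp
  | tmul a b => simp [TensorProduct.mapIncl, h b b.2]
  | add x y hx hy => simp [hx, hy]

theorem rTensor_mapIncl_congr {f g : C →ₗ[k] k} {D : Submodule k C} (h : ∀ c ∈ D, f c = g c)
    (t : D ⊗[k] D) :
    f.rTensor C (TensorProduct.mapIncl D D t) = g.rTensor C (TensorProduct.mapIncl D D t) := by
  induction t with
  | zero => simp
  | tmul a b => simp [TensorProduct.mapIncl, h a a.2]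
  | add x y hx hy => simp [hx, hy]

theorem map_mem_range_mapIncl {q : C →ₗ[k] C} {D : Submodule k C} (hq : ∀ c, q c ∈ D)
    (t : C ⊗[k] C) :
    TensorProduct.map q q t ∈ LinearMap.range (TensorProduct.mapIncl D D) := by
  refine ⟨TensorProduct.map (q.codRestrict D hq) (q.codRestrict D hq) t, ?_⟩
  induction t with
  | zero => simp
  | tmul a b => simp [TensorProduct.mapIncl]
  | add x y hx hy => simp only [map_add, hx, hy]

theorem range_mapIncl_mono {D E : Submodule k C} (h : D ≤ E) :
    LinearMap.range (TensorProduct.mapIncl D D) ≤ LinearMap.range (TensorProduct.mapIncl E E) := by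
  rintro _ ⟨t, rfl⟩
  refine ⟨TensorProduct.map (Submodule.inclusion h) (Submodule.inclusion h) t, ?_⟩
  induction t with
  | zero => simp
  | tmul a b => simp [TensorProduct.mapIncl]
  | add x y hx hy => simp only [map_add, hx, hy]

variable [Coalgebra k C]

theorem isSubcoalgebra_sSup {s : Set (Submodule k C)} (hs : ∀ D ∈ s, IsSubcoalgebra k D) :
    IsSubcoalgebra k (sSup s) := by
  suffices h : sSup s ≤ (LinearMap.range (TensorProduct.mapIncl (sSup s)
      (sSup s))).comap (comul (R := k)) from fun c hc => h hc
  exact sSup_le fun D hD c hc => range_mapIncl_mono (le_sSup hD) (hs D hD c hc)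

theorem IsSubcoalgebra.sup {D E : Submodule k C} (hD : IsSubcoalgebra k D)
    (hE : IsSubcoalgebra k E) : IsSubcoalgebra k (D ⊔ E) := by
  rw [← sSup_pair]
  refine isSubcoalgebra_sSup ?_
  rintro F (rfl | rfl) <;> assumption

/-- `c ↦ c₍₁₎ f(c₍₂₎)`. -/
noncomputable def hitLeft (f : C →ₗ[k] k) : C →ₗ[k] C :=
  (TensorProduct.rid k C).toLinearMap ∘ₗ f.lTensor C ∘ₗ comul

/-- `c ↦ f(c₍₁₎) c₍₂₎`. -/
noncomputable def hitRight (f : C →ₗ[k] k) : C →ₗ[k] C :=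
  (TensorProduct.lid k C).toLinearMap ∘ₗ f.rTensor C ∘ₗ comul

theorem hitLeft_apply (f : C →ₗ[k] k) (c : C) :
    hitLeft f c = TensorProduct.rid k C (f.lTensor C (comul c)) := rfl

theorem hitRight_apply (f : C →ₗ[k] k) (c : C) :
    hitRight f c = TensorProduct.lid k C (f.rTensor C (comul c)) := rfl

theorem counit_hitLeft (f : C →ₗ[k] k) (c : C) : counit (R := k) (hitLeft f c) = f c := by
  have h : ∀ t : C ⊗[k] C, counit (R := k) (TensorProduct.rid k C (f.lTensor C t)) =
      f (TensorProduct.lid k C ((counit (R := k)).rTensor C t)) := fun t => by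
    induction t with
    | zero => simp
    | tmul a b => simp [mul_comm]
    | add x y hx hy => simp only [map_add, hx, hy]
  rw [hitLeft_apply, h, rTensor_counit_comul]
  simp

theorem counit_hitRight (f : C →ₗ[k] k) (c : C) : counit (R := k) (hitRight f c) = f c := by
  have h : ∀ t : C ⊗[k] C, counit (R := k) (TensorProduct.lid k C (f.rTensor C t)) =
      f (TensorProduct.rid k C ((counit (R := k)).lTensor C t)) := fun t => by
    induction t with
    | zero => simp
    | tmul a b => simp [mul_comm]
    | add x y hx hy => simp only [map_add, hx, hy]
  rw [hitRight_apply, h, lTensor_counit_comul]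
  simp

theorem comul_hitLeft (f : C →ₗ[k] k) (c : C) :
    comul (R := k) (hitLeft f c) = (hitLeft f).lTensor C (comul c) := by
  have h : ∀ t : C ⊗[k] C, comul (R := k) (TensorProduct.rid k C (f.lTensor C t)) =
      ((TensorProduct.rid k C).toLinearMap ∘ₗ f.lTensor C).lTensor C
        (TensorProduct.assoc k C C C ((comul (R := k)).rTensor C t)) := fun t => by
    induction t with
    | zero => simp
    | tmul a b =>
      simp only [LinearMap.lTensor_tmul, TensorProduct.rid_tmul, map_smul, LinearMap.rTensor_tmul]
      generalize (comul (R := k) a) = u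
      induction u with
      | zero => simp
      | tmul p q => simp
      | add x y hx hy => simp only [smul_add, TensorProduct.add_tmul, map_add, hx, hy]
    | add x y hx hy => simp only [map_add, hx, hy]
  rw [hitLeft_apply, h, coassoc_apply, ← LinearMap.comp_apply, ← LinearMap.lTensor_comp]
  rfl

theorem comul_hitRight (f : C →ₗ[k] k) (c : C) :
    comul (R := k) (hitRight f c) = (hitRight f).rTensor C (comul c) := by
  have h : ∀ t : C ⊗[k] C, comul (R := k) (TensorProduct.lid k C (f.rTensor C t)) =
      ((TensorProduct.lid k C).toLinearMap ∘ₗ f.rTensor C).rTensor C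
        ((TensorProduct.assoc k C C C).symm ((comul (R := k)).lTensor C t)) := fun t => by
    induction t with
    | zero => simp
    | tmul a b =>
      simp only [LinearMap.rTensor_tmul, TensorProduct.lid_tmul, map_smul, LinearMap.lTensor_tmul]
      generalize (comul (R := k) b) = u
      induction u with
      | zero => simp
      | tmul p q => simp [TensorProduct.smul_tmul']
      | add x y hx hy => simp only [smul_add, TensorProduct.tmul_add, map_add, hx, hy]
    | add x y hx hy => simp only [map_add, hx, hy]
  rw [hitRight_apply, h, coassoc_symm_apply, ← LinearMap.comp_apply, ← LinearMap.rTensor_comp]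
  rfl

theorem IsSubcoalgebra.hitRight_mem {D : Submodule k C} (hD : IsSubcoalgebra k D)
    (f : C →ₗ[k] k) {c : C} (hc : c ∈ D) : hitRight f c ∈ D := by
  obtain ⟨t, ht⟩ := hD c hc
  rw [hitRight_apply, ← ht]
  exact lid_rTensor_mapIncl_mem f D t

theorem IsSubcoalgebra.hitLeft_eq {D : Submodule k C} (hD : IsSubcoalgebra k D)
    {f g : C →ₗ[k] k} (h : ∀ c ∈ D, f c = g c) {c : C} (hc : c ∈ D) :
    hitLeft f c = hitLeft g c := by
  obtain ⟨t, ht⟩ := hD c hc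
  rw [hitLeft_apply, hitLeft_apply, ← ht, lTensor_mapIncl_congr h]

theorem IsSubcoalgebra.hitRight_eq {D : Submodule k C} (hD : IsSubcoalgebra k D)
    {f g : C →ₗ[k] k} (h : ∀ c ∈ D, f c = g c) {c : C} (hc : c ∈ D) :
    hitRight f c = hitRight g c := by
  obtain ⟨t, ht⟩ := hD c hc
  rw [hitRight_apply, hitRight_apply, ← ht, rTensor_mapIncl_congr h]

theorem hitLeft_counit (c : C) : hitLeft (counit (R := k)) c = c := by
  simp [hitLeft_apply]

theorem hitRight_counit (c : C) : hitRight (counit (R := k)) c = c := by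
  simp [hitRight_apply]

/-- Both sides are `g(c₁) c₂ f(c₃)`. Applying the counit later turns this into comparisons of
functionals. -/
theorem hitLeft_hitRight (f g : C →ₗ[k] k) (c : C) :
    hitLeft f (hitRight g c) = hitRight g (hitLeft f c) := by
  rw [hitLeft_apply f (hitRight g c), comul_hitRight, hitLeft_apply f c]
  generalize comul (R := k) c = t
  induction t with
  | zero => simp
  | tmul a b => simp
  | add x y hx hy => simp only [map_add, hx, hy]

theorem IsCoseparabilityPairing.comul_rTensor {ψ : C ⊗[k] C →ₗ[k] k}
    (hψ : IsCoseparabilityPairing k ψ) (t : C ⊗[k] C) :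
    TensorProduct.rid k C (ψ.lTensor C
      (TensorProduct.assoc k C C C ((comul (R := k)).rTensor C t))) =
    TensorProduct.lid k C (ψ.rTensor C
      ((TensorProduct.assoc k C C C).symm ((comul (R := k)).lTensor C t))) := by
  induction t with
  | zero => simp
  | tmul a b => simpa using hψ.1 a b
  | add x y hx hy => simp only [map_add, hx, hy]

/-- A linear projection onto `D`, averaged by `ψ` on either side, gives functionals `e` and `f`.
They turn out to be the same central idempotent, and `K` is the part of `C` that it kills. -/
theorem IsCoseparabilityPairing.exists_isCompl {ψ : C ⊗[k] C →ₗ[k] k}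
    (hψ : IsCoseparabilityPairing k ψ) {D : Submodule k C} (hD : IsSubcoalgebra k D) :
    ∃ K : Submodule k C, IsSubcoalgebra k K ∧ IsCompl D K := by
  obtain ⟨g, hg⟩ := D.subtype.exists_leftInverse_of_injective D.ker_subtype
  have hgD : ∀ c : D, g c = c := fun c => LinearMap.congr_fun hg c
  let p : C →ₗ[k] C := D.subtype ∘ₗ g
  have hpD : ∀ c ∈ D, p c = c := fun c hc => congrArg Subtype.val (hgD ⟨c, hc⟩)
  have hp : ∀ c, p c ∈ D := fun c => (g c).2
  let e : C →ₗ[k] k := ψ ∘ₗ p.lTensor C ∘ₗ comul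
  let f : C →ₗ[k] k := ψ ∘ₗ p.rTensor C ∘ₗ comul
  have fix : ∀ (t : D ⊗[k] D), p.lTensor C (TensorProduct.mapIncl D D t) =
      TensorProduct.mapIncl D D t ∧ p.rTensor C (TensorProduct.mapIncl D D t) =
      TensorProduct.mapIncl D D t := fun t => by
    induction t with
    | zero => simp
    | tmul a b => simp [TensorProduct.mapIncl, hpD]
    | add x y hx hy => simp only [map_add, hx, hy, and_self]
  have heD : ∀ c ∈ D, e c = counit (R := k) c := fun c hc => by
    obtain ⟨t, ht⟩ := hD c hc
    rw [← hψ.2 c, ← ht, ← (fix t).1, ht]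
    rfl
  have hfD : ∀ c ∈ D, f c = counit (R := k) c := fun c hc => by
    obtain ⟨t, ht⟩ := hD c hc
    rw [← hψ.2 c, ← ht, ← (fix t).2, ht]
    rfl
  -- Coseparability rewrites `c₁ ψ(c₂ ⊗ p(c₃))` as `ψ(c₁ ⊗ p(c₂)₁) p(c₂)₂`, which lies in `D`
  -- because `D` is a subcoalgebra.
  have he : ∀ c, hitLeft e c ∈ D := fun c => by
    have h1 : hitLeft e c = TensorProduct.rid k C (ψ.lTensor C
        (TensorProduct.assoc k C C C ((comul (R := k)).rTensor C (p.lTensor C (comul c))))) := by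
      rw [← LinearMap.comp_apply (f := LinearMap.rTensor C comul), LinearMap.rTensor_comp_lTensor,
        ← LinearMap.lTensor_comp_rTensor, LinearMap.comp_apply]
      have h2 : ∀ t : (C ⊗[k] C) ⊗[k] C, TensorProduct.assoc k C C C (p.lTensor (C ⊗[k] C) t) =
          (p.lTensor C).lTensor C (TensorProduct.assoc k C C C t) := fun t =>
        LinearMap.congr_fun (f := (TensorProduct.assoc k C C C).toLinearMap ∘ₗ
            p.lTensor (C ⊗[k] C)) (g := (p.lTensor C).lTensor C ∘ₗ
              (TensorProduct.assoc k C C C).toLinearMap) (by ext; simp) t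
      rw [h2, coassoc_apply, hitLeft_apply]
      simp only [e, LinearMap.lTensor_comp, LinearMap.comp_apply]
    rw [h1, hψ.comul_rTensor]
    generalize comul (R := k) c = t
    induction t with
    | zero => simp
    | tmul a b =>
      obtain ⟨u, hu⟩ := hD _ (hp b)
      rw [LinearMap.lTensor_tmul, LinearMap.lTensor_tmul, ← hu]
      clear hu
      induction u with
      | zero => simp
      | tmul x y => simpa [TensorProduct.mapIncl] using D.smul_mem _ y.2
      | add x y hx hy =>
        simp only [map_add, TensorProduct.tmul_add] at hx hy ⊢
        exact D.add_mem hx hy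
    | add x y hx hy =>
      simp only [map_add]
      exact D.add_mem hx hy
  have hf : ∀ c, hitRight f c ∈ D := fun c => by
    have h1 : hitRight f c = TensorProduct.lid k C (ψ.rTensor C
        ((TensorProduct.assoc k C C C).symm
          ((comul (R := k)).lTensor C (p.rTensor C (comul c))))) := by
      rw [← LinearMap.comp_apply (f := LinearMap.lTensor C comul), LinearMap.lTensor_comp_rTensor,
        ← LinearMap.rTensor_comp_lTensor, LinearMap.comp_apply]
      have h2 : ∀ t : C ⊗[k] (C ⊗[k] C),
          (TensorProduct.assoc k C C C).symm (p.rTensor (C ⊗[k] C) t) =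
          (p.rTensor C).rTensor C ((TensorProduct.assoc k C C C).symm t) := fun t =>
        LinearMap.congr_fun (f := (TensorProduct.assoc k C C C).symm.toLinearMap ∘ₗ
            p.rTensor (C ⊗[k] C)) (g := (p.rTensor C).rTensor C ∘ₗ
              (TensorProduct.assoc k C C C).symm.toLinearMap) (by ext; simp) t
      rw [h2, coassoc_symm_apply, hitRight_apply]
      simp only [f, LinearMap.rTensor_comp, LinearMap.comp_apply]
    rw [h1, ← hψ.comul_rTensor]
    generalize comul (R := k) c = t
    induction t with
    | zero => simp
    | tmul a b =>
      obtain ⟨u, hu⟩ := hD _ (hp a)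
      rw [LinearMap.rTensor_tmul, LinearMap.rTensor_tmul, ← hu]
      clear hu
      induction u with
      | zero => simp
      | tmul x y => simpa [TensorProduct.mapIncl] using D.smul_mem _ x.2
      | add x y hx hy =>
        simp only [map_add, TensorProduct.add_tmul] at hx hy ⊢
        exact D.add_mem hx hy
    | add x y hx hy =>
      simp only [map_add]
      exact D.add_mem hx hy
  -- Both functionals restrict to the counit on `D`, where the two actions land; so evaluating the
  -- commuting actions under the counit gives `f` one way and `e` the other.
  have hef : e = f := by
    ext c
    have h1 := congrArg (counit (R := k)) (hitLeft_hitRight e f c)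
    rwa [counit_hitLeft, counit_hitRight, heD _ (hf c), hfD _ (he c), counit_hitLeft,
      counit_hitRight, eq_comm] at h1
  rw [← hef] at hf
  have hcomm : ∀ c, hitLeft e c = hitRight e c := fun c => by
    have h1 := hitLeft_hitRight e e c
    rwa [hD.hitLeft_eq heD (hf c), hD.hitRight_eq heD (he c), hitLeft_counit, hitRight_counit,
      eq_comm] at h1
  have hidem : ∀ c ∈ D, hitLeft e c = c := fun c hc => by
    rw [hD.hitLeft_eq heD hc, hitLeft_counit]
  refine ⟨LinearMap.ker (hitLeft e), fun c hc => ?_, ?_⟩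
  -- For `c` in the kernel, centrality lets `e` annihilate each leg of `Δ(c)`; hence `Δ(c)` is fixed
  -- by `(1 - e) ⊗ (1 - e)`, which maps into the tensor square of the kernel.
  · have hq : ∀ c, (LinearMap.id - hitLeft e : C →ₗ[k] C) c ∈ LinearMap.ker (hitLeft e) :=
        fun c => by simp [hidem _ (he c)]
    have h1 : (hitLeft e).lTensor C (comul (R := k) c) = 0 := by
      rw [← comul_hitLeft, LinearMap.mem_ker.1 hc, map_zero]
    have h2 : (hitLeft e).rTensor C (comul (R := k) c) = 0 := by
      rw [show hitLeft e = hitRight e from LinearMap.ext hcomm, ← comul_hitRight, ← hcomm,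
        LinearMap.mem_ker.1 hc, map_zero]
    convert map_mem_range_mapIncl hq (comul (R := k) c) using 1
    rw [← LinearMap.rTensor_comp_lTensor, LinearMap.comp_apply, LinearMap.lTensor_sub,
      LinearMap.rTensor_sub]
    simp [h1, h2]
  · refine IsCompl.of_le (fun c hc => ?_) fun c _ => ?_
    · rw [Submodule.mem_bot, ← hidem c hc.1]
      exact hc.2
    · rw [← add_sub_cancel (hitLeft e c) c]
      refine Submodule.add_mem_sup (he c) ?_
      simp [hidem _ (he c)]

/-- A nonzero complement of the coradical would contain a minimal nonzero subcoalgebra, which is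
simple and so already lies in the coradical. -/
theorem IsCoseparabilityPairing.isCosemisimple [FiniteDimensional k C] {ψ : C ⊗[k] C →ₗ[k] k}
    (hψ : IsCoseparabilityPairing k ψ) : IsCosemisimple k C := by
  obtain ⟨K, hK, hcompl⟩ := hψ.exists_isCompl
    (isSubcoalgebra_sSup (s := {D : Submodule k C | IsSimpleSubcoalgebra k D}) fun _ hD => hD.1)
  rw [IsCosemisimple, coradical]
  suffices h : K = ⊥ by simpa [h] using hcompl.sup_eq_top
  by_contra hne
  obtain ⟨E, hEK, hE⟩ := exists_minimal_le_of_wellFoundedLT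
    (fun E : Submodule k C => IsSubcoalgebra k E ∧ E ≠ ⊥) K ⟨hK, hne⟩
  have hsimple : IsSimpleSubcoalgebra k E := by
    refine ⟨hE.1.1, hE.1.2, fun F hF hFs => or_iff_not_imp_left.2 fun hF0 => ?_⟩
    exact le_antisymm hF (hE.2 ⟨hFs, hF0⟩ hF)
  exact hE.1.2 (disjoint_self.1 (hcompl.disjoint.mono (le_sSup hsimple) hEK))

end CoseparableCoalgebras

/-! ### The normalized integral of a cosemisimple bialgebra. -/

section NormalizedIntegral

open Coalgebra

variable {k : Type*} [Field k] {H : Type*} [Ring H] [Bialgebra k H]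

theorem isSubcoalgebra_span_one : IsSubcoalgebra k (Submodule.span k {(1 : H)}) := by
  intro c hc
  obtain ⟨r, rfl⟩ := Submodule.mem_span_singleton.1 hc
  refine ⟨r • (⟨1, Submodule.mem_span_singleton_self 1⟩ ⊗ₜ[k]
    ⟨1, Submodule.mem_span_singleton_self 1⟩), ?_⟩
  simp [TensorProduct.mapIncl, Algebra.TensorProduct.one_def]

/-- If `1 = d + e`, a functional `f` vanishing on `D` with `f(1) ≠ 0` kills `d` when it acts, so
`f(1) 1` is the image of `e` and lies in `E`. -/
theorem one_notMem_sup {D E : Submodule k H} (hD : IsSubcoalgebra k D) (hE : IsSubcoalgebra k E)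
    (h1D : (1 : H) ∉ D) (h1E : (1 : H) ∉ E) : (1 : H) ∉ D ⊔ E := by
  intro h
  obtain ⟨f, hf1, hfD⟩ := Submodule.exists_le_ker_of_notMem h1D
  obtain ⟨d, hd, e, he, hde⟩ := Submodule.mem_sup.1 h
  have h0 : hitRight f d = 0 := by
    rw [hD.hitRight_eq (g := 0) (fun c hc => hfD hc) hd]
    simp [hitRight_apply]
  have h1 : hitRight f (1 : H) ∈ E := by
    rw [← hde, map_add, h0, zero_add]
    exact hE.hitRight_mem f he
  rw [hitRight_apply, Bialgebra.comul_one, Algebra.TensorProduct.one_def] at h1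
  simp only [LinearMap.rTensor_tmul, TensorProduct.lid_tmul] at h1
  exact h1E ((E.smul_mem_iff hf1).1 h1)

variable (k H) in
/-- A cosemisimple bialgebra has a linear form that is a left and a right integral on it and
takes the value `1` at `1`. -/
theorem exists_twoSided_integral (hH : IsCosemisimple k H) :
    ∃ lam : H →ₗ[k] k, (∀ h, hitLeft lam h = lam h • (1 : H)) ∧
      (∀ h, hitRight lam h = lam h • (1 : H)) ∧ lam 1 = 1 := by
  have h10 : (1 : H) ≠ 0 := fun h => by
    simpa [Bialgebra.counit_one] using congrArg (counit (R := k)) h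
  let s : Set (Submodule k H) := {D | IsSubcoalgebra k D ∧ (1 : H) ∉ D}
  have hM : IsSubcoalgebra k (sSup s) := isSubcoalgebra_sSup fun _ h => h.1
  have h1M : (1 : H) ∉ sSup s := by
    have hne : s.Nonempty := ⟨⊥, fun c hc => by
      rw [(Submodule.mem_bot k).1 hc]; simp, by simpa using h10⟩
    -- Directedness makes the supremum a union, so `1` avoids the whole sum because it avoids each
    -- member.
    have hdir : DirectedOn (· ≤ ·) s := fun D hD E hE =>
      ⟨D ⊔ E, ⟨hD.1.sup hE.1, one_notMem_sup hD.1 hE.1 hD.2 hE.2⟩, le_sup_left, le_sup_right⟩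
    rw [Submodule.mem_sSup_of_directed hne hdir]
    rintro ⟨D, hD, h⟩
    exact hD.2 h
  have htop : sSup s ⊔ Submodule.span k {(1 : H)} = ⊤ := by
    rw [eq_top_iff, ← show coradical k H = ⊤ from hH]
    refine sSup_le fun D hD => ?_
    -- A simple subcoalgebra containing `1` equals `k1`; any other one belongs to `s`.
    by_cases h1 : (1 : H) ∈ D
    · refine le_sup_of_le_right ?_
      have hle : Submodule.span k {(1 : H)} ≤ D := by
        rwa [Submodule.span_singleton_le_iff_mem]
      rcases hD.2.2 _ hle isSubcoalgebra_span_one with h | h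
      · exact absurd (Submodule.span_singleton_eq_bot.1 h) h10
      · exact h.ge
    · exact le_sup_of_le_left (le_sSup ⟨hD.1, h1⟩)
  obtain ⟨f, hf1, hfM⟩ := Submodule.exists_le_ker_of_notMem h1M
  let lam : H →ₗ[k] k := (f 1)⁻¹ • f
  have hlam1 : lam 1 = 1 := by simp [lam, hf1]
  have hlamM : ∀ c ∈ sSup s, lam c = (0 : H →ₗ[k] k) c := fun c hc => by
    simp [lam, LinearMap.mem_ker.1 (hfM hc)]
  have decomp : ∀ h : H, ∃ m ∈ sSup s, ∃ r : k, m + r • 1 = h := fun h => by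
    obtain ⟨m, hm, x, hx, hmx⟩ := Submodule.mem_sup.1 (htop ▸ Submodule.mem_top : h ∈ _)
    obtain ⟨r, rfl⟩ := Submodule.mem_span_singleton.1 hx
    exact ⟨m, hm, r, hmx⟩
  refine ⟨lam, fun h => ?_, fun h => ?_, hlam1⟩
  · obtain ⟨m, hm, r, rfl⟩ := decomp h
    rw [map_add, hM.hitLeft_eq hlamM hm, map_add, hlamM m hm]
    simp [hitLeft_apply, Algebra.TensorProduct.one_def, hlam1]
  · obtain ⟨m, hm, r, rfl⟩ := decomp h
    rw [map_add, hM.hitRight_eq hlamM hm, map_add, hlamM m hm]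
    simp [hitRight_apply, Algebra.TensorProduct.one_def, hlam1]

/-- A normalized left integral on a bialgebra with a normalized right integral is unique. -/
theorem left_integral_eq_right_integral {lam lam' : H →ₗ[k] k}
    (hl : ∀ h, hitLeft lam h = lam h • (1 : H)) (hl1 : lam 1 = 1)
    (hr : ∀ h, hitRight lam' h = lam' h • (1 : H)) (hr1 : lam' 1 = 1) : lam = lam' := by
  ext h
  have h1 := congrArg (counit (R := k)) (hitLeft_hitRight lam lam' h)
  simpa [counit_hitLeft, counit_hitRight, hl, hr, hl1, hr1, eq_comm] using h1

end NormalizedIntegral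

end HopfTwist

namespace HopfTwist

/-! ### Antipode contractions and the anti-comultiplicativity of the antipode. -/

section Antipode

open Coalgebra HopfAlgebra

variable {k : Type*} [Field k] {H : Type*} [Ring H] [HopfAlgebra k H]

theorem mul'_antipode_rTensor_comul (h : H) :
    LinearMap.mul' k H ((antipode k).rTensor H (comul h)) = counit (R := k) h • (1 : H) := by
  rw [mul_antipode_rTensor_comul_apply, Algebra.algebraMap_eq_smul_one]

theorem mul'_antipode_lTensor_comul (h : H) :
    LinearMap.mul' k H ((antipode k).lTensor H (comul h)) = counit (R := k) h • (1 : H) := by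
  rw [mul_antipode_lTensor_comul_apply, Algebra.algebraMap_eq_smul_one]

variable (k H) in
/-- `a ⊗ b ⊗ c ↦ S(a) b ⊗ c`. -/
noncomputable def contractLeft : H ⊗[k] (H ⊗[k] H) →ₗ[k] H ⊗[k] H :=
  (LinearMap.mul' k H ∘ₗ (antipode k).rTensor H).rTensor H ∘ₗ
    (TensorProduct.assoc k H H H).symm.toLinearMap

variable (k H) in
/-- `a ⊗ b ⊗ c ↦ a S(b) ⊗ c`. -/
noncomputable def contractMid : H ⊗[k] (H ⊗[k] H) →ₗ[k] H ⊗[k] H :=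
  (LinearMap.mul' k H ∘ₗ (antipode k).lTensor H).rTensor H ∘ₗ
    (TensorProduct.assoc k H H H).symm.toLinearMap

variable (k H) in
/-- `a ⊗ b ⊗ c ↦ a ⊗ b S(c)`. -/
noncomputable def contractRight : H ⊗[k] (H ⊗[k] H) →ₗ[k] H ⊗[k] H :=
  (LinearMap.mul' k H ∘ₗ (antipode k).lTensor H).lTensor H

variable (k H) in
/-- `a ⊗ b ⊗ c ↦ a ⊗ S(b) c`. -/
noncomputable def contractRightInner : H ⊗[k] (H ⊗[k] H) →ₗ[k] H ⊗[k] H :=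
  (LinearMap.mul' k H ∘ₗ (antipode k).rTensor H).lTensor H

@[simp]
theorem contractRightInner_tmul (a b c : H) :
    contractRightInner k H (a ⊗ₜ (b ⊗ₜ c)) = a ⊗ₜ (antipode k b * c) := rfl

@[simp]
theorem contractLeft_tmul (a b c : H) :
    contractLeft k H (a ⊗ₜ (b ⊗ₜ c)) = (antipode k a * b) ⊗ₜ c := rfl

@[simp]
theorem contractMid_tmul (a b c : H) :
    contractMid k H (a ⊗ₜ (b ⊗ₜ c)) = (a * antipode k b) ⊗ₜ c := rfl

@[simp]
theorem contractRight_tmul (a b c : H) :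
    contractRight k H (a ⊗ₜ (b ⊗ₜ c)) = a ⊗ₜ (b * antipode k c) := rfl

theorem contractLeft_comul_comul (h : H) :
    contractLeft k H ((comul (R := k)).lTensor H (comul h)) = 1 ⊗ₜ h := by
  rw [← coassoc_apply]
  have : ∀ t : H ⊗[k] H, contractLeft k H (TensorProduct.assoc k H H H
      ((comul (R := k)).rTensor H t)) =
      1 ⊗ₜ (TensorProduct.lid k H ((counit (R := k)).rTensor H t)) := fun t => by
    induction t with
    | zero => simp
    | tmul a b =>
      simp [contractLeft, TensorProduct.smul_tmul', Algebra.algebraMap_eq_smul_one]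
    | add x y hx hy => simp only [map_add, hx, hy, TensorProduct.tmul_add]
  rw [this, rTensor_counit_comul]
  simp

theorem contractMid_comul_comul (h : H) :
    contractMid k H ((comul (R := k)).lTensor H (comul h)) = 1 ⊗ₜ h := by
  rw [← coassoc_apply]
  have : ∀ t : H ⊗[k] H, contractMid k H (TensorProduct.assoc k H H H
      ((comul (R := k)).rTensor H t)) =
      1 ⊗ₜ (TensorProduct.lid k H ((counit (R := k)).rTensor H t)) := fun t => by
    induction t with
    | zero => simp
    | tmul a b =>
      simp [contractMid, TensorProduct.smul_tmul', Algebra.algebraMap_eq_smul_one]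
    | add x y hx hy => simp only [map_add, hx, hy, TensorProduct.tmul_add]
  rw [this, rTensor_counit_comul]
  simp

theorem contractRight_comul_comul (h : H) :
    contractRight k H ((comul (R := k)).lTensor H (comul h)) = h ⊗ₜ 1 := by
  have : ∀ t : H ⊗[k] H, contractRight k H ((comul (R := k)).lTensor H t) =
      (TensorProduct.rid k H ((counit (R := k)).lTensor H t)) ⊗ₜ 1 := fun t => by
    induction t with
    | zero => simp
    | tmul a b =>
      simp [contractRight, TensorProduct.smul_tmul', Algebra.algebraMap_eq_smul_one]
    | add x y hx hy => simp only [map_add, hx, hy, TensorProduct.add_tmul]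
  simp [this]

theorem contractRightInner_comul_comul (h : H) :
    contractRightInner k H ((comul (R := k)).lTensor H (comul h)) = h ⊗ₜ 1 := by
  have : ∀ t : H ⊗[k] H, contractRightInner k H ((comul (R := k)).lTensor H t) =
      (TensorProduct.rid k H ((counit (R := k)).lTensor H t)) ⊗ₜ 1 := fun t => by
    induction t with
    | zero => simp
    | tmul a b =>
      simp [contractRightInner, TensorProduct.smul_tmul', Algebra.algebraMap_eq_smul_one]
    | add x y hx hy => simp only [map_add, hx, hy, TensorProduct.add_tmul]
  simp [this]

variable (k H) in
/-- `a ⊗ b ↦ S(b) ⊗ S(a)`. -/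
noncomputable def antipodeSwap : H ⊗[k] H →ₗ[k] H ⊗[k] H :=
  TensorProduct.map (antipode k) (antipode k) ∘ₗ (TensorProduct.comm k H H).toLinearMap

@[simp]
theorem antipodeSwap_tmul (a b : H) :
    antipodeSwap k H (a ⊗ₜ b) = antipode k b ⊗ₜ antipode k a := rfl

theorem antipodeSwap_mul (x y : H ⊗[k] H) :
    antipodeSwap k H (x * y) = antipodeSwap k H y * antipodeSwap k H x := by
  induction x with
  | zero => simp
  | add x x' hx hx' => simp only [add_mul, map_add, hx, hx', mul_add]
  | tmul a b =>
    induction y with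
    | zero => simp
    | add y y' hy hy' => simp only [add_mul, map_add, hy, hy', mul_add]
    | tmul c d => simp [antipode_mul_antidistrib]

theorem antipode_tmul_one_mul_comul (a b : H) :
    LinearMap.mul' k (H ⊗[k] H) (TensorProduct.map ((TensorProduct.mk k H H).flip 1 ∘ₗ antipode k)
      comul (a ⊗ₜ[k] b)) = contractLeft k H ((comul (R := k)).lTensor H (a ⊗ₜ[k] b)) := by
  simp only [TensorProduct.map_tmul, LinearMap.lTensor_tmul, LinearMap.mul'_apply]
  generalize comul (R := k) b = t
  induction t with
  | zero => simp
  | add x y hx hy => simp only [mul_add, TensorProduct.tmul_add, map_add, hx, hy]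
  | tmul c d => simp

/-- `(S(h₍₁₎) ⊗ 1) Δ(h₍₂₎) = 1 ⊗ h`. -/
theorem sum_antipode_tmul_one_mul_comul (h : H) :
    LinearMap.mul' k (H ⊗[k] H) (TensorProduct.map ((TensorProduct.mk k H H).flip 1 ∘ₗ antipode k)
      comul (comul (R := k) h)) = 1 ⊗ₜ h := by
  rw [← contractLeft_comul_comul]
  generalize comul (R := k) h = t
  induction t with
  | zero => simp
  | add x y hx hy => simp only [map_add, hx, hy]
  | tmul c d => exact antipode_tmul_one_mul_comul c d

variable (k H) in
/-- `a ⊗ b ⊗ c ↦ (S(b) ⊗ S(a)) Δ(c)`. -/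
noncomputable def contractSwap : H ⊗[k] (H ⊗[k] H) →ₗ[k] H ⊗[k] H :=
  LinearMap.mul' k (H ⊗[k] H) ∘ₗ TensorProduct.map (antipodeSwap k H) comul ∘ₗ
    (TensorProduct.assoc k H H H).symm.toLinearMap

@[simp]
theorem contractSwap_tmul (a b c : H) :
    contractSwap k H (a ⊗ₜ (b ⊗ₜ c)) = (antipode k b ⊗ₜ antipode k a) * comul c := rfl

theorem contractSwap_tmul_eq (a : H) (t : H ⊗[k] H) :
    contractSwap k H (a ⊗ₜ t) = (1 ⊗ₜ antipode k a) *
      LinearMap.mul' k (H ⊗[k] H) (TensorProduct.map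
        ((TensorProduct.mk k H H).flip 1 ∘ₗ antipode k) comul t) := by
  induction t with
  | zero => simp
  | add x y hx hy => simp only [mul_add, TensorProduct.tmul_add, map_add, hx, hy]
  | tmul c d => simp [← mul_assoc]

/-- The antipode is an anti-coalgebra map. -/
theorem comul_antipode (h : H) :
    comul (R := k) (antipode k h) = antipodeSwap k H (comul h) := by
  -- In the convolution algebra of maps `H → H ⊗ H`, `Δ` has `Δ ∘ S` as a right inverse; showing the
  -- swapped expression to be a left inverse forces the two to agree.
  have key : WithConv.toConv (antipodeSwap k H ∘ₗ comul (R := k)) *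
      WithConv.toConv (comul (R := k) (A := H)) = 1 := by
    apply WithConv.ext
    ext c
    simp only [LinearMap.convMul_def, LinearMap.convOne_def, WithConv.ofConv_toConv]
    have h1 : ∀ t : H ⊗[k] H, LinearMap.mul' k (H ⊗[k] H)
        (TensorProduct.map (antipodeSwap k H ∘ₗ comul (R := k)) comul t) =
        contractSwap k H (TensorProduct.assoc k H H H ((comul (R := k)).rTensor H t)) :=
      fun t => by
      induction t with
      | zero => simp
      | add x y hx hy => simp only [map_add, hx, hy]
      | tmul c d => simp [contractSwap]
    have h2 : ∀ t : H ⊗[k] H, contractSwap k H ((comul (R := k)).lTensor H t) =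
        1 ⊗ₜ LinearMap.mul' k H ((antipode k).rTensor H t) := fun t => by
      induction t with
      | zero => simp
      | add x y hx hy => simp only [map_add, hx, hy, TensorProduct.tmul_add]
      | tmul c d =>
        rw [LinearMap.lTensor_tmul, contractSwap_tmul_eq, sum_antipode_tmul_one_mul_comul]
        simp
    simp only [LinearMap.comp_apply]
    rw [h1, coassoc_apply, h2, mul'_antipode_rTensor_comul]
    simp [Algebra.algebraMap_eq_smul_one, Algebra.TensorProduct.one_def]
  have := left_inv_eq_right_inv key LinearMap.comul_right_inv
  exact (LinearMap.congr_fun (congrArg WithConv.ofConv this) h).symm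

end Antipode

/-! ### Integrals: invariance formulas, nondegeneracy, and the Nakayama automorphism. -/

section Integrals

open Coalgebra HopfAlgebra

variable {k : Type*} [Field k] {H : Type*} [Ring H] [HopfAlgebra k H]

/-- `a ⊗ b ↦ lam(b S(d)) a`. -/
noncomputable def pairRight (lam : H →ₗ[k] k) (d : H) : H ⊗[k] H →ₗ[k] H :=
  (TensorProduct.rid k H).toLinearMap ∘ₗ
    (lam ∘ₗ LinearMap.mulRight k (antipode k d)).lTensor H

/-- `a ⊗ b ↦ lam(x S(a)) b`. -/
noncomputable def pairLeft (lam : H →ₗ[k] k) (x : H) : H ⊗[k] H →ₗ[k] H :=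
  (TensorProduct.lid k H).toLinearMap ∘ₗ
    (lam ∘ₗ LinearMap.mulLeft k x ∘ₗ antipode k).rTensor H

@[simp]
theorem pairRight_tmul (lam : H →ₗ[k] k) (d a b : H) :
    pairRight lam d (a ⊗ₜ b) = lam (b * antipode k d) • a := rfl

@[simp]
theorem pairLeft_tmul (lam : H →ₗ[k] k) (x a b : H) :
    pairLeft lam x (a ⊗ₜ b) = lam (x * antipode k a) • b := rfl

variable {lam : H →ₗ[k] k}

/-- `x₍₁₎ lam(x₍₂₎ S(d)) = lam(x S(d₍₁₎)) d₍₂₎` for a left integral `lam`. -/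
theorem IsLeftIntegralOn.pairRight_comul (hl : IsLeftIntegralOn lam) (x d : H) :
    pairRight lam d (comul x) = pairLeft lam x (comul d) := by
  let lamR : H ⊗[k] H →ₗ[k] H := (TensorProduct.rid k H).toLinearMap ∘ₗ lam.lTensor H
  -- With `X = Δ(x)`, expand `λ(x S(d₁)) d₂` by left invariance to `x₁ S(d₂) λ(x₂ S(d₁)) d₃`; then
  -- `S(d₂) d₃` collapses. Freeing `X` allows a reduction to pure tensors.
  have key : ∀ X : H ⊗[k] H, LinearMap.mul' k H
      ((lamR ∘ₗ LinearMap.mul k (H ⊗[k] H) X ∘ₗ comul ∘ₗ antipode k).rTensor H (comul d)) =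
      pairRight lam d X := fun X => by
    induction X with
    | zero => simp
    | add x y hx hy =>
      simp only [map_add, LinearMap.add_comp, LinearMap.comp_add, LinearMap.rTensor_add,
        LinearMap.add_apply, hx, hy]
    | tmul p q =>
      let g : H ⊗[k] H →ₗ[k] H := (TensorProduct.lid k H).toLinearMap ∘ₗ
        TensorProduct.map (lam ∘ₗ LinearMap.mulLeft k q ∘ₗ antipode k) (LinearMap.mulLeft k p)
      have h1 : ∀ t : H ⊗[k] H, LinearMap.mul' k H ((lamR ∘ₗ LinearMap.mul k (H ⊗[k] H) (p ⊗ₜ q) ∘ₗ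
          comul ∘ₗ antipode k).rTensor H t) = g (contractRightInner k H
            (TensorProduct.assoc k H H H ((comul (R := k)).rTensor H t))) := fun t => by
        induction t with
        | zero => simp
        | add x y hx hy => simp only [map_add, hx, hy]
        | tmul a b =>
          simp only [LinearMap.rTensor_tmul, LinearMap.comp_apply, comul_antipode,
            LinearMap.mul'_apply]
          generalize comul (R := k) a = u
          induction u with
          | zero => simp
          | add x y hx hy => simp only [map_add, add_mul, TensorProduct.add_tmul, hx, hy]
          | tmul c e => simp [lamR, g, mul_assoc]
      rw [h1, coassoc_apply, contractRightInner_comul_comul]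
      simp [g]
  rw [← key]
  generalize comul (R := k) d = t
  induction t with
  | zero => simp
  | add x y hx hy => simp only [map_add, hx, hy]
  | tmul a b =>
    have h := hl (x * antipode k a)
    rw [Bialgebra.comul_mul] at h
    simp only [LinearMap.rTensor_tmul, LinearMap.mul'_apply, pairLeft_tmul, lamR,
      LinearMap.comp_apply, LinearMap.mul_apply', LinearEquiv.coe_coe]
    rw [h, smul_mul_assoc, one_mul]

/-- `lam(x₍₁₎ b) x₍₂₎ = lam(x b₍₁₎) S(b₍₂₎)` for a right integral `lam`. -/
theorem sum_right_integral_mul (hr : ∀ h, hitRight lam h = lam h • (1 : H)) (x b : H) :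
    TensorProduct.lid k H ((lam ∘ₗ LinearMap.mulRight k b).rTensor H (comul x)) =
      TensorProduct.lid k H (TensorProduct.map (lam ∘ₗ LinearMap.mulLeft k x) (antipode k)
        (comul b)) := by
  let lamL : H ⊗[k] H →ₗ[k] H := (TensorProduct.lid k H).toLinearMap ∘ₗ lam.rTensor H
  -- Right invariance expands `λ(x b₁) S(b₂)` to `λ(x₁ b₁) x₂ b₂ S(b₃)`, and `b₂ S(b₃)` collapses.
  have key : ∀ X : H ⊗[k] H, LinearMap.mul' k H
      (TensorProduct.map (lamL ∘ₗ LinearMap.mul k (H ⊗[k] H) X ∘ₗ comul) (antipode k) (comul b)) =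
      TensorProduct.lid k H ((lam ∘ₗ LinearMap.mulRight k b).rTensor H X) := fun X => by
    induction X with
    | zero => simp
    | add x y hx hy =>
      simp only [map_add, LinearMap.add_comp, LinearMap.comp_add, TensorProduct.map_add_left,
        LinearMap.add_apply, hx, hy]
    | tmul p q =>
      let g : H ⊗[k] H →ₗ[k] H := (TensorProduct.lid k H).toLinearMap ∘ₗ
        TensorProduct.map (lam ∘ₗ LinearMap.mulLeft k p) (LinearMap.mulLeft k q)
      have h1 : ∀ t : H ⊗[k] H, LinearMap.mul' k H (TensorProduct.map
          (lamL ∘ₗ LinearMap.mul k (H ⊗[k] H) (p ⊗ₜ q) ∘ₗ comul) (antipode k) t) =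
          g (contractRight k H
            (TensorProduct.assoc k H H H ((comul (R := k)).rTensor H t))) := fun t => by
        induction t with
        | zero => simp
        | add x y hx hy => simp only [map_add, hx, hy]
        | tmul a b =>
          simp only [LinearMap.rTensor_tmul, LinearMap.comp_apply, TensorProduct.map_tmul,
            LinearMap.mul'_apply]
          generalize comul (R := k) a = u
          induction u with
          | zero => simp
          | add x y hx hy => simp only [map_add, add_mul, TensorProduct.add_tmul, hx, hy]
          | tmul c e => simp [lamL, g, mul_assoc]
      rw [h1, coassoc_apply, contractRight_comul_comul]
      simp [g]
  rw [← key]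
  generalize comul (R := k) b = t
  induction t with
  | zero => simp
  | add x y hx hy => simp only [map_add, hx, hy]
  | tmul a b =>
    have h := hr (x * a)
    rw [hitRight_apply, Bialgebra.comul_mul] at h
    simp only [TensorProduct.map_tmul, LinearMap.mul'_apply, lamL,
      LinearMap.comp_apply, LinearMap.mul_apply', LinearEquiv.coe_coe, h, smul_mul_assoc, one_mul,
      TensorProduct.lid_tmul, LinearMap.mulLeft_apply]

/-- `b₍₁₎ lam(a b₍₂₎) = S(a₍₁₎) lam(a₍₂₎ b)` for a left integral `lam`. -/
theorem IsLeftIntegralOn.sum_mul (hl : IsLeftIntegralOn lam) (a b : H) :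
    TensorProduct.rid k H ((lam ∘ₗ LinearMap.mulLeft k a).lTensor H (comul b)) =
      TensorProduct.rid k H (TensorProduct.map (antipode k) (lam ∘ₗ LinearMap.mulRight k b)
        (comul a)) := by
  let lamR : H ⊗[k] H →ₗ[k] H := (TensorProduct.rid k H).toLinearMap ∘ₗ lam.lTensor H
  -- Left invariance expands `S(a₁) λ(a₂ b)` to `S(a₁) a₂ b₁ λ(a₃ b₂)`, and `S(a₁) a₂` collapses.
  have key : ∀ X : H ⊗[k] H, LinearMap.mul' k H (TensorProduct.map (antipode k)
      (lamR ∘ₗ (LinearMap.mul k (H ⊗[k] H)).flip X ∘ₗ comul) (comul a)) =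
      TensorProduct.rid k H ((lam ∘ₗ LinearMap.mulLeft k a).lTensor H X) := fun X => by
    induction X with
    | zero => simp
    | add x y hx hy =>
      simp only [map_add, LinearMap.add_comp, LinearMap.comp_add, TensorProduct.map_add_right,
        LinearMap.add_apply, hx, hy]
    | tmul p q =>
      let g : H ⊗[k] H →ₗ[k] H := (TensorProduct.rid k H).toLinearMap ∘ₗ
        TensorProduct.map (LinearMap.mulRight k p) (lam ∘ₗ LinearMap.mulRight k q)
      have h1 : ∀ t : H ⊗[k] H, LinearMap.mul' k H (TensorProduct.map (antipode k)
          (lamR ∘ₗ (LinearMap.mul k (H ⊗[k] H)).flip (p ⊗ₜ q) ∘ₗ comul) t) =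
          g (contractLeft k H ((comul (R := k)).lTensor H t)) := fun t => by
        induction t with
        | zero => simp
        | add x y hx hy => simp only [map_add, hx, hy]
        | tmul a b =>
          simp only [LinearMap.lTensor_tmul, LinearMap.comp_apply, TensorProduct.map_tmul,
            LinearMap.mul'_apply]
          generalize comul (R := k) b = u
          induction u with
          | zero => simp
          | add x y hx hy => simp only [map_add, mul_add, TensorProduct.tmul_add, hx, hy]
          | tmul c e => simp [lamR, g, mul_assoc]
      rw [h1, contractLeft_comul_comul]
      simp [g]
  rw [← key]
  generalize comul (R := k) a = t
  induction t with
  | zero => simp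
  | add x y hx hy => simp only [map_add, hx, hy]
  | tmul c d =>
    have h := hl (d * b)
    rw [Bialgebra.comul_mul] at h
    simp only [TensorProduct.map_tmul, LinearMap.mul'_apply, lamR, LinearMap.flip_apply,
      LinearMap.comp_apply, LinearMap.mul_apply', LinearEquiv.coe_coe, h, mul_smul_comm, mul_one,
      TensorProduct.rid_tmul, LinearMap.mulRight_apply]

/-- A right integral with `lam 1 ≠ 0` on a finite-dimensional Hopf algebra is a nondegenerate
form. -/
theorem eq_zero_of_right_integral_mul [FiniteDimensional k H]
    (hr : ∀ h, hitRight lam h = lam h • (1 : H)) (h1 : lam 1 ≠ 0) {a : H}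
    (ha : ∀ b, lam (a * b) = 0) : a = 0 := by
  let Θ : H →ₗ[k] Module.Dual k H := (LinearMap.mul k H).compr₂ lam
  -- Tested against `b`, this is `λ(a₁ b) a₂ = λ(a b₁) S(b₂) = 0`; finite dimension makes such tests
  -- detect zero in `H* ⊗ H`.
  have hΘ : Θ.rTensor H (comul a) = 0 := by
    apply (dualTensorHomEquiv k H H).injective
    ext b
    have h2 : ∀ t : H ⊗[k] H, dualTensorHomEquiv k H H (Θ.rTensor H t) b =
        TensorProduct.lid k H ((lam ∘ₗ LinearMap.mulRight k b).rTensor H t) := fun t => by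
      induction t with
      | zero => simp
      | add x y hx hy => simp only [map_add, LinearMap.add_apply, hx, hy]
      | tmul c d => simp [Θ]
    rw [h2, sum_right_integral_mul hr, map_zero, LinearMap.zero_apply,
      show lam ∘ₗ LinearMap.mulLeft k a = 0 from LinearMap.ext ha]
    simp
  -- Evaluating the functional `λ(a₁ ·)` at `S(a₂)` recovers `λ(a₁ S(a₂)) a₃ = λ(1) a` from the
  -- vanishing tensor.
  let g : Module.Dual k H ⊗[k] (H ⊗[k] H) →ₗ[k] H := (TensorProduct.lid k H).toLinearMap ∘ₗ
    (_root_.contractLeft k H ∘ₗ (antipode k).lTensor (Module.Dual k H)).rTensor H ∘ₗ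
    (TensorProduct.assoc k (Module.Dual k H) H H).symm.toLinearMap
  have h3 : ∀ t : H ⊗[k] H, g ((comul (R := k)).lTensor _ (Θ.rTensor H t)) =
      TensorProduct.lid k H (lam.rTensor H (contractMid k H ((comul (R := k)).lTensor H t))) :=
    fun t => by
    induction t with
    | zero => simp
    | add x y hx hy => simp only [map_add, hx, hy]
    | tmul c d =>
      simp only [LinearMap.lTensor_tmul, LinearMap.rTensor_tmul]
      generalize comul (R := k) d = u
      induction u with
      | zero => simp
      | add x y hx hy => simp only [map_add, TensorProduct.tmul_add, hx, hy]
      | tmul p q => simp [g, Θ]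
  have h4 := h3 (comul a)
  rw [hΘ, contractMid_comul_comul] at h4
  simpa [h1, eq_comm (a := (0 : H))] using h4

/-- A normalized two-sided integral on a finite-dimensional unimodular Hopf algebra satisfies
`lam(y x) = lam(x S²(y))`. -/
theorem IsLeftIntegralOn.apply_mul_comm [FiniteDimensional k H] (hl : IsLeftIntegralOn lam)
    (hr : ∀ h, hitRight lam h = lam h • (1 : H)) (h1 : lam 1 = 1) (hu : IsUnimodular k H)
    (y x : H) : lam (y * x) = lam (x * antipode k (antipode k y)) := by
  have hnd : ∀ a : H, (∀ b, lam (a * b) = 0) → a = 0 := fun a ha =>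
    eq_zero_of_right_integral_mul hr (by simp [h1]) ha
  let Θ : H →ₗ[k] Module.Dual k H := (LinearMap.mul k H).compr₂ lam
  have hΘ : Function.Surjective Θ := by
    rw [← LinearMap.injective_iff_surjective_of_finrank_eq_finrank
      Subspace.dual_finrank_eq.symm, injective_iff_map_eq_zero]
    exact fun a ha => hnd a fun b => LinearMap.congr_fun ha b
  -- The element representing `ε` through `λ` is a right integral by nondegeneracy, and a left one
  -- by unimodularity.
  obtain ⟨t, ht⟩ := hΘ (counit (R := k))
  have ht : ∀ b, lam (t * b) = counit (R := k) b := fun b => LinearMap.congr_fun ht b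
  have htR : ∀ h : H, t * h = counit (R := k) h • t := fun h => by
    rw [← sub_eq_zero]
    refine hnd _ fun b => ?_
    rw [sub_mul, map_sub, mul_assoc, ht, smul_mul_assoc, map_smul, ht, Bialgebra.counit_mul,
      smul_eq_mul, sub_self]
  have htL := (hu t).2 htR
  have ht1 : lam t = 1 := by simpa using ht 1
  have hmulLeft : lam ∘ₗ LinearMap.mulLeft k t = counit := LinearMap.ext ht
  have hmulRight : lam ∘ₗ LinearMap.mulRight k t = counit := LinearMap.ext fun a => by
    simp [htL, ht1]
  -- The two-sided integral reconstructs the antipode: `λ(t₁ b) t₂ = S(b)` here, `t₁ λ(a t₂) = S(a)`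
  -- in `hS'`, while `hpair` gives `t₁ λ(t₂ S(z)) = z`.
  have hS : ∀ b, TensorProduct.lid k H ((lam ∘ₗ LinearMap.mulRight k b).rTensor H (comul t)) =
      antipode k b := fun b => by
    rw [sum_right_integral_mul hr, hmulLeft, ← LinearMap.lTensor_comp_rTensor,
      LinearMap.comp_apply, rTensor_counit_comul]
    simp
  have hS' : ∀ a, TensorProduct.rid k H ((lam ∘ₗ LinearMap.mulLeft k a).lTensor H (comul t)) =
      antipode k a := fun a => by
    rw [hl.sum_mul, hmulRight, ← LinearMap.rTensor_comp_lTensor,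
      LinearMap.comp_apply, lTensor_counit_comul]
    simp
  have hpair : ∀ z, pairRight lam z (comul t) = z := fun z => by
    rw [hl.pairRight_comul]
    have : lam ∘ₗ LinearMap.mulLeft k t ∘ₗ antipode k = counit := by
      rw [← LinearMap.comp_assoc, hmulLeft, counit_comp_antipode]
    simp [pairLeft, this]
  -- The formula `x₁ λ(t x₂) = S(t₁) λ(t₂ x)` has left side `x`, which exhibits a preimage under
  -- `S`.
  have hsurj : ∃ c, antipode k c = x := by
    have h2 := hl.sum_mul t x
    rw [hmulLeft, lTensor_counit_comul, ← LinearMap.rTensor_comp_lTensor,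
      LinearMap.comp_apply] at h2
    have h3 : ∀ u : H ⊗[k] k, antipode k (TensorProduct.rid k H u) =
        TensorProduct.rid k H ((antipode k).rTensor k u) := fun u => by
      induction u with
      | zero => simp
      | add x y hx hy => simp only [map_add, hx, hy]
      | tmul p q => simp
    rw [TensorProduct.rid_tmul, one_smul] at h2
    exact ⟨_, (h3 _).trans h2.symm⟩
  obtain ⟨c, rfl⟩ := hsurj
  -- With `x = S(c) = λ(t₁ c) t₂`, both `λ(y S(c))` and `λ(S(c) S²(y))` become `λ(S(y) c)`: the
  -- first by `hS'`, the second by `hpair` at `z = S(y)`.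
  have h3 : ∀ u : H ⊗[k] H,
      lam (y * TensorProduct.lid k H ((lam ∘ₗ LinearMap.mulRight k c).rTensor H u)) =
      lam (TensorProduct.rid k H ((lam ∘ₗ LinearMap.mulLeft k y).lTensor H u) * c) := fun u => by
    induction u with
    | zero => simp
    | add x y hx hy => simp only [map_add, mul_add, add_mul, hx, hy]
    | tmul p q => simp [mul_comm]
  have h4 : ∀ (w : H) (u : H ⊗[k] H),
      lam (TensorProduct.lid k H ((lam ∘ₗ LinearMap.mulRight k c).rTensor H u) * antipode k w) =
      lam (pairRight lam w u * c) := fun w u => by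
    induction u with
    | zero => simp
    | add x y hx hy => simp only [map_add, add_mul, hx, hy]
    | tmul p q => simp [mul_comm]
  have h5 := h3 (comul t)
  have h6 := h4 (antipode k y) (comul t)
  rw [hS, hS'] at h5
  rw [hS, hpair] at h6
  rw [h5, h6]

end Integrals

end HopfTwist

namespace HopfTwist

/-! ### Twist identities and the coseparability pairing. -/

section Twists

open Coalgebra HopfAlgebra

variable {k : Type*} [Field k] {H : Type*} [Ring H] [HopfAlgebra k H]

/-- On pure tensors the second leg is `y w₁ S(y' w₂) = y w₁ S(w₂) S(y')`, so the coproduct collapses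
to a counit. The other rules for products under a contraction use the same anti-multiplicativity. -/
theorem contractRight_one_tmul_mul (Y Z : H ⊗[k] H) :
    contractRight k H ((1 ⊗ₜ Y) * (comul (R := k)).lTensor H Z) =
      counitRight Z ⊗ₜ LinearMap.mul' k H ((antipode k).lTensor H Y) := by
  have key : ∀ (z y y' : H) (u : H ⊗[k] H), contractRight k H (z ⊗ₜ ((y ⊗ₜ y') * u)) =
      z ⊗ₜ (y * LinearMap.mul' k H ((antipode k).lTensor H u) * antipode k y') :=
    fun z y y' u => by
    induction u with
    | zero => simp
    | add x y hx hy => simp only [map_add, mul_add, add_mul, TensorProduct.tmul_add, hx, hy]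
    | tmul p q => simp [antipode_mul_antidistrib, mul_assoc]
  induction Z with
  | zero => simp
  | add x y hx hy => simp only [map_add, mul_add, TensorProduct.add_tmul, hx, hy]
  | tmul z w =>
    induction Y with
    | zero => simp
    | add x y hx hy => simp only [map_add, add_mul, TensorProduct.tmul_add, hx, hy]
    | tmul y y' =>
      rw [LinearMap.lTensor_tmul, Algebra.TensorProduct.tmul_mul_tmul, one_mul, key,
        mul'_antipode_lTensor_comul]
      simp [counitRight_apply, TensorProduct.smul_tmul]

theorem contractRight_assoc_tmul_one_mul (X : H ⊗[k] H) (W : H ⊗[k] (H ⊗[k] H)) :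
    contractRight k H (TensorProduct.assoc k H H H (X ⊗ₜ 1) * W) = X * contractRight k H W := by
  induction X with
  | zero => simp
  | add x y hx hy => simp only [map_add, add_mul, TensorProduct.add_tmul, hx, hy]
  | tmul a b =>
    induction W with
    | zero => simp
    | add x y hx hy => simp only [map_add, mul_add, hx, hy]
    | tmul w W =>
      induction W with
      | zero => simp
      | add x y hx hy => simp only [map_add, mul_add, TensorProduct.tmul_add, hx, hy]
      | tmul p q => simp [mul_assoc]

theorem contractMid_mul_assoc (X Y Z : H ⊗[k] H) :
    contractMid k H ((1 ⊗ₜ X) * TensorProduct.assoc k H H H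
      ((Y ⊗ₜ 1) * (comul (R := k)).rTensor H Z)) =
    (LinearMap.mul' k H ((antipode k).lTensor H Y) ⊗ₜ 1) *
      ((antipode k).rTensor H X * (1 ⊗ₜ counitLeft Z)) := by
  have key : ∀ (a b y y' z' : H) (u : H ⊗[k] H), contractMid k H ((1 ⊗ₜ (a ⊗ₜ b)) *
      TensorProduct.assoc k H H H (((y ⊗ₜ y') * u) ⊗ₜ z')) =
      (y * LinearMap.mul' k H ((antipode k).lTensor H u) * antipode k y' * antipode k a) ⊗ₜ
        (b * z') := fun a b y y' z' u => by
    induction u with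
    | zero => simp
    | add x y hx hy => simp only [map_add, mul_add, add_mul, TensorProduct.add_tmul, hx, hy]
    | tmul p q => simp [antipode_mul_antidistrib, mul_assoc]
  induction Z with
  | zero => simp
  | add x y hx hy => simp only [map_add, mul_add, TensorProduct.tmul_add, hx, hy]
  | tmul z w =>
    induction Y with
    | zero => simp
    | add x y hx hy => simp only [map_add, add_mul, mul_add, TensorProduct.add_tmul, hx, hy]
    | tmul y y' =>
      induction X with
      | zero => simp
      | add x y hx hy => simp only [map_add, add_mul, mul_add, TensorProduct.tmul_add, hx, hy]
      | tmul a b =>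
        rw [LinearMap.rTensor_tmul, Algebra.TensorProduct.tmul_mul_tmul, one_mul, key,
          mul'_antipode_lTensor_comul]
        simp [counitLeft_apply, TensorProduct.smul_tmul', mul_assoc]

theorem contractLeft_assoc_mul (W Y Z : H ⊗[k] H) :
    contractLeft k H (TensorProduct.assoc k H H H ((comul (R := k)).rTensor H Z * (Y ⊗ₜ 1)) *
      (1 ⊗ₜ W)) =
    (LinearMap.mul' k H ((antipode k).rTensor H Y) ⊗ₜ 1) * ((1 ⊗ₜ counitLeft Z) * W) := by
  have key : ∀ (a b y y' z' : H) (u : H ⊗[k] H), contractLeft k H (TensorProduct.assoc k H H H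
      ((u * (y ⊗ₜ y')) ⊗ₜ z') * (1 ⊗ₜ (a ⊗ₜ b))) =
      (antipode k y * LinearMap.mul' k H ((antipode k).rTensor H u) * y' * a) ⊗ₜ
        (z' * b) := fun a b y y' z' u => by
    induction u with
    | zero => simp
    | add x y hx hy => simp only [map_add, mul_add, add_mul, TensorProduct.add_tmul, hx, hy]
    | tmul p q => simp [antipode_mul_antidistrib, mul_assoc]
  induction Z with
  | zero => simp
  | add x y hx hy => simp only [map_add, mul_add, add_mul, TensorProduct.tmul_add, hx, hy]
  | tmul z w =>
    induction Y with
    | zero => simp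
    | add x y hx hy => simp only [map_add, add_mul, mul_add, TensorProduct.add_tmul, hx, hy]
    | tmul y y' =>
      induction W with
      | zero => simp
      | add x y hx hy => simp only [map_add, mul_add, TensorProduct.tmul_add, hx, hy]
      | tmul a b =>
        rw [LinearMap.rTensor_tmul, Algebra.TensorProduct.tmul_mul_tmul, mul_one, key,
          mul'_antipode_rTensor_comul]
        simp [counitLeft_apply, TensorProduct.smul_tmul', mul_assoc]

/-- Together with `contractSwap_lTensor_mul`, this evaluates `contractSwap` on the two sides of the
twist equation, yielding the coproduct of `Q_J`. -/
theorem contractSwap_assoc_mul (Y Z : H ⊗[k] H) :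
    contractSwap k H (TensorProduct.assoc k H H H
      ((comul (R := k)).rTensor H Z * (Y ⊗ₜ 1))) =
    antipodeSwap k H Y * comul (R := k) (LinearMap.mul' k H ((antipode k).rTensor H Z)) := by
  induction Z with
  | zero => simp
  | add x y hx hy => simp only [map_add, mul_add, add_mul, hx, hy]
  | tmul z w =>
    simp [contractSwap, antipodeSwap_mul, comul_antipode, mul_assoc]

theorem contractLeft_tmul_eq (a : H) (u : H ⊗[k] H) :
    contractLeft k H (a ⊗ₜ u) = (antipode k a ⊗ₜ 1) * u := by
  induction u with
  | zero => simp
  | add x y hx hy => simp only [map_add, mul_add, TensorProduct.tmul_add, hx, hy]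
  | tmul p q => simp

theorem contractSwap_lTensor_mul (Y Z : H ⊗[k] H) :
    contractSwap k H ((comul (R := k)).lTensor H Z * (1 ⊗ₜ Y)) =
    (1 ⊗ₜ LinearMap.mul' k H ((antipode k).rTensor H Z)) *
      contractLeft k H ((comul (R := k)).lTensor H Y) := by
  have key : ∀ (y y' : H) (u : H ⊗[k] H), LinearMap.mul' k (H ⊗[k] H) (TensorProduct.map
      ((TensorProduct.mk k H H).flip 1 ∘ₗ antipode k) comul (u * (y ⊗ₜ y'))) =
      (antipode k y ⊗ₜ 1) * LinearMap.mul' k (H ⊗[k] H) (TensorProduct.map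
      ((TensorProduct.mk k H H).flip 1 ∘ₗ antipode k) comul u) * comul y' := fun y y' u => by
    induction u with
    | zero => simp
    | add x y hx hy => simp only [map_add, mul_add, add_mul, hx, hy]
    | tmul p q =>
      simp only [Algebra.TensorProduct.tmul_mul_tmul, TensorProduct.map_tmul,
        LinearMap.mul'_apply, LinearMap.comp_apply, antipode_mul_antidistrib,
        LinearMap.flip_apply, TensorProduct.mk_apply, Bialgebra.comul_mul, ← mul_assoc, mul_one]
  induction Z with
  | zero => simp
  | add x y hx hy => simp only [map_add, add_mul, TensorProduct.tmul_add, hx, hy]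
  | tmul z w =>
    induction Y with
    | zero => simp
    | add x y hx hy => simp only [map_add, mul_add, TensorProduct.tmul_add, hx, hy]
    | tmul y y' =>
      rw [LinearMap.lTensor_tmul, Algebra.TensorProduct.tmul_mul_tmul, mul_one,
        contractSwap_tmul_eq, key, sum_antipode_tmul_one_mul_comul, LinearMap.lTensor_tmul,
        contractLeft_tmul_eq]
      simp [← mul_assoc]

variable (J : Twist k H)

/-- `J (1 ⊗ Q_J⁻¹) = J⁻⁽¹⁾₍₁₎ ⊗ J⁻⁽¹⁾₍₂₎ S(J⁻⁽²⁾)`. -/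
theorem Twist.contractRight_inv :
    contractRight k H (TensorProduct.assoc k H H H ((comul (R := k)).rTensor H
      ((J.elt⁻¹ : (H ⊗[k] H)ˣ) : H ⊗[k] H))) = (J.elt : H ⊗[k] H) * (1 ⊗ₜ J.Qinv) := by
  have h : TensorProduct.assoc k H H H ((comul (R := k)).rTensor H
      ((J.elt⁻¹ : (H ⊗[k] H)ˣ) : H ⊗[k] H)) =
      TensorProduct.assoc k H H H ((J.elt : H ⊗[k] H) ⊗ₜ 1) *
      ((1 ⊗ₜ ((J.elt⁻¹ : (H ⊗[k] H)ˣ) : H ⊗[k] H)) *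
        (comul (R := k)).lTensor H ((J.elt⁻¹ : (H ⊗[k] H)ˣ) : H ⊗[k] H)) := by
    rw [← J.inv_twist_eq, ← assoc_mul, ← mul_assoc, Algebra.TensorProduct.tmul_mul_tmul,
      Units.mul_inv, one_mul, ← Algebra.TensorProduct.one_def, one_mul]
  rw [h, contractRight_assoc_tmul_one_mul, contractRight_one_tmul_mul, J.counitRight_inv]
  rfl

/-- `Q_J⁻¹ S(J⁽¹⁾) ⊗ J⁽²⁾ = J⁻⁽¹⁾ S(J⁻⁽²⁾₍₁₎) ⊗ J⁻⁽²⁾₍₂₎`. -/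
theorem Twist.contractMid_inv :
    contractMid k H ((comul (R := k)).lTensor H ((J.elt⁻¹ : (H ⊗[k] H)ˣ) : H ⊗[k] H)) =
      (J.Qinv ⊗ₜ 1) * (antipode k).rTensor H (J.elt : H ⊗[k] H) := by
  have h : (comul (R := k)).lTensor H ((J.elt⁻¹ : (H ⊗[k] H)ˣ) : H ⊗[k] H) =
      (1 ⊗ₜ (J.elt : H ⊗[k] H)) * TensorProduct.assoc k H H H
        ((((J.elt⁻¹ : (H ⊗[k] H)ˣ) : H ⊗[k] H) ⊗ₜ 1) *
          (comul (R := k)).rTensor H ((J.elt⁻¹ : (H ⊗[k] H)ˣ) : H ⊗[k] H)) := by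
    rw [J.inv_twist_eq, ← mul_assoc, Algebra.TensorProduct.tmul_mul_tmul,
      Units.mul_inv, one_mul, ← Algebra.TensorProduct.one_def, one_mul]
  rw [h, contractMid_mul_assoc, J.counitLeft_inv, ← Algebra.TensorProduct.one_def, mul_one]
  rfl

/-- `S(J⁽¹⁾) J⁽²⁾₍₁₎ ⊗ J⁽²⁾₍₂₎ = (Q_J ⊗ 1) J⁻¹`. -/
theorem Twist.contractLeft_elt :
    contractLeft k H ((comul (R := k)).lTensor H (J.elt : H ⊗[k] H)) =
      (J.Q ⊗ₜ 1) * ((J.elt⁻¹ : (H ⊗[k] H)ˣ) : H ⊗[k] H) := by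
  have h : (comul (R := k)).lTensor H (J.elt : H ⊗[k] H) =
      TensorProduct.assoc k H H H ((comul (R := k)).rTensor H (J.elt : H ⊗[k] H) *
        ((J.elt : H ⊗[k] H) ⊗ₜ 1)) * (1 ⊗ₜ ((J.elt⁻¹ : (H ⊗[k] H)ˣ) : H ⊗[k] H)) := by
    rw [J.twist_eq, mul_assoc, Algebra.TensorProduct.tmul_mul_tmul,
      Units.mul_inv, one_mul, ← Algebra.TensorProduct.one_def, mul_one]
  rw [h, contractLeft_assoc_mul, show counitLeft (J.elt : H ⊗[k] H) = 1 from J.counit_left,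
    ← Algebra.TensorProduct.one_def, one_mul]
  rfl

/-- `(S(J⁽²⁾) ⊗ S(J⁽¹⁾)) Δ(Q_J) = (Q_J ⊗ Q_J) J⁻¹`. -/
theorem Twist.antipodeSwap_mul_comul_Q :
    antipodeSwap k H (J.elt : H ⊗[k] H) * comul (R := k) J.Q =
      (J.Q ⊗ₜ J.Q) * ((J.elt⁻¹ : (H ⊗[k] H)ˣ) : H ⊗[k] H) := by
  -- Contracting the other side of the twist equation gives `(1 ⊗ Q_J)(Q_J ⊗ 1) J⁻¹`.
  rw [Twist.Q, ← contractSwap_assoc_mul, J.twist_eq, contractSwap_lTensor_mul,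
    J.contractLeft_elt, ← mul_assoc]
  simp [Twist.Q]

/-- Multiply the legs in `Twist.contractMid_inv`: one side is `Q_J⁻¹ S(J⁽¹⁾) J⁽²⁾`, the other loses
`S(J⁻⁽²⁾₁) J⁻⁽²⁾₂` to the counit. -/
theorem Twist.Qinv_mul_Q : J.Qinv * J.Q = 1 := by
  have h1 : ∀ Z : H ⊗[k] H, LinearMap.mul' k H (contractMid k H ((comul (R := k)).lTensor H Z)) =
      counitRight Z := fun Z => by
    induction Z with
    | zero => simp
    | add x y hx hy => simp only [map_add, hx, hy]
    | tmul a b =>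
      have h2 : ∀ u : H ⊗[k] H, LinearMap.mul' k H (contractMid k H (a ⊗ₜ u)) =
          a * LinearMap.mul' k H ((antipode k).rTensor H u) := fun u => by
        induction u with
        | zero => simp
        | add x y hx hy => simp only [map_add, mul_add, TensorProduct.tmul_add, hx, hy]
        | tmul p q => simp [mul_assoc]
      rw [LinearMap.lTensor_tmul, h2, mul'_antipode_rTensor_comul]
      simp [counitRight_apply]
  have h3 : ∀ (q : H) (X : H ⊗[k] H), LinearMap.mul' k H ((q ⊗ₜ 1) * X) =
      q * LinearMap.mul' k H X := fun q X => by
    induction X with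
    | zero => simp
    | add x y hx hy => simp only [map_add, mul_add, hx, hy]
    | tmul a b => simp [mul_assoc]
  rw [Twist.Q, ← h3, ← J.contractMid_inv, h1, J.counitRight_inv]

/-- `a ⊗ b ↦ a q S(b)`. -/
noncomputable def sandwich (q : H) : H ⊗[k] H →ₗ[k] H :=
  LinearMap.mul' k H ∘ₗ TensorProduct.map (LinearMap.mulRight k q) (antipode k)

@[simp]
theorem sandwich_tmul (q a b : H) :
    sandwich q (a ⊗ₜ[k] b) = a * q * antipode k b := rfl

/-- This makes `sandwich` a left action of `H ⊗ H` on `H`, so `L⁻¹ Δ(h) J` can be applied one factor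
at a time. -/
theorem sandwich_mul (q : H) (X Y : H ⊗[k] H) :
    sandwich q (X * Y) = sandwich (sandwich q Y) X := by
  induction X with
  | zero => simp
  | add x y hx hy => simp only [map_add, add_mul, hx, hy]
  | tmul a b =>
    rw [sandwich_tmul]
    induction Y with
    | zero => simp
    | add x y hx hy => simp only [map_add, mul_add, add_mul, hx, hy]
    | tmul c d => simp [antipode_mul_antidistrib, mul_assoc]

theorem sandwich_smul_one (r : k) (X : H ⊗[k] H) :
    sandwich (r • (1 : H)) X = r • LinearMap.mul' k H ((antipode k).lTensor H X) := by
  induction X with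
  | zero => simp
  | add x y hx hy => simp only [map_add, smul_add, hx, hy]
  | tmul a b => simp

theorem sandwich_one (X : H ⊗[k] H) :
    sandwich (1 : H) X = LinearMap.mul' k H ((antipode k).lTensor H X) := by
  simpa using sandwich_smul_one (1 : k) X

theorem Twist.sandwich_Qinv : sandwich J.Qinv (J.elt : H ⊗[k] H) = 1 := by
  rw [Twist.Qinv, ← sandwich_one, ← sandwich_mul, Units.mul_inv]
  simp [Algebra.TensorProduct.one_def]

theorem sandwich_Qinv_twistedComul (L : Twist k H) (h : H) :
    sandwich J.Qinv (twistedComul L J h) = counit (R := k) h • L.Qinv := by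
  rw [twistedComul_apply, sandwich_mul, sandwich_mul, J.sandwich_Qinv, sandwich_one,
    mul'_antipode_lTensor_comul, sandwich_smul_one]
  rfl

variable {lam : H →ₗ[k] k}

/-- The coseparability identity for the one-sided twist `H^(1,J)`. -/
theorem IsLeftIntegralOn.pairRight_comul_twist (hl : IsLeftIntegralOn lam) (c d : H) :
    pairRight lam d (comul c * (J.elt : H ⊗[k] H) * (1 ⊗ₜ J.Qinv)) =
      pairLeft lam (c * J.Qinv) (comul d * (J.elt : H ⊗[k] H)) := by
  -- The map is `(a ⊗ b, e ⊗ f) ↦ a S(e) ⊗ f b`, so `g` with `D = Δ(d)` sends `a ⊗ b` to `λ(c a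
  -- S(d₁)) d₂ b`.
  let mix : H ⊗[k] H →ₗ[k] H ⊗[k] H →ₗ[k] H ⊗[k] H :=
    TensorProduct.map₂ ((LinearMap.mul k H).compl₂ (antipode k)) (LinearMap.mul k H).flip
  let g : H ⊗[k] H → H ⊗[k] H →ₗ[k] H := fun D =>
    (TensorProduct.lid k H).toLinearMap ∘ₗ (lam ∘ₗ LinearMap.mulLeft k c).rTensor H ∘ₗ mix.flip D
  have hg : ∀ D X, g D X =
      TensorProduct.lid k H ((lam ∘ₗ LinearMap.mulLeft k c).rTensor H (mix X D)) :=
    fun _ _ => rfl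
  -- For `Z = y ⊗ z`, this is the untwisted identity at `c y` and `d z`. At `Z = J⁻¹` the two
  -- contractions become `J (1 ⊗ Q_J⁻¹)` and `Q_J⁻¹ S(J⁽¹⁾) ⊗ J⁽²⁾`.
  have key : ∀ Z : H ⊗[k] H, pairRight lam d (comul c * contractRight k H
      (TensorProduct.assoc k H H H ((comul (R := k)).rTensor H Z))) =
      g (comul d) (contractMid k H ((comul (R := k)).lTensor H Z)) := fun Z => by
    induction Z with
    | zero => simp
    | add x y hx hy => simp only [map_add, mul_add, hx, hy]
    | tmul y z =>
      have h1 : ∀ u : H ⊗[k] H, contractRight k H (TensorProduct.assoc k H H H (u ⊗ₜ z)) =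
          u * (1 ⊗ₜ antipode k z) := fun u => by
        induction u with
        | zero => simp
        | add x y hx hy => simp only [map_add, add_mul, TensorProduct.add_tmul, hx, hy]
        | tmul p q => simp
      have h2 : ∀ u : H ⊗[k] H, pairRight lam d (u * (1 ⊗ₜ antipode k z)) =
          pairRight lam (d * z) u := fun u => by
        induction u with
        | zero => simp
        | add x y hx hy => simp only [map_add, add_mul, hx, hy]
        | tmul p q => simp [antipode_mul_antidistrib, mul_assoc]
      have h3 : ∀ D u : H ⊗[k] H, g D (contractMid k H (y ⊗ₜ u)) =
          pairLeft lam (c * y) (D * u) := fun D u => by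
        rw [hg]
        induction u with
        | zero => simp
        | add x y hx hy =>
          simp only [map_add, mul_add, TensorProduct.tmul_add, LinearMap.add_apply, hx, hy]
        | tmul p q =>
          induction D with
          | zero => simp
          | add x y hx hy => simp only [map_add, add_mul, hx, hy]
          | tmul e f => simp [mix, antipode_mul_antidistrib, mul_assoc]
      rw [LinearMap.rTensor_tmul, LinearMap.lTensor_tmul, h1, h3, ← mul_assoc, h2,
        ← Bialgebra.comul_mul, ← Bialgebra.comul_mul, hl.pairRight_comul]
  have h4 : ∀ (q : H) (D X : H ⊗[k] H), g D ((q ⊗ₜ 1) * (antipode k).rTensor H X) =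
      pairLeft lam (c * q) (D * X) := fun q D X => by
    rw [hg]
    induction X with
    | zero => simp
    | add x y hx hy => simp only [map_add, mul_add, LinearMap.add_apply, hx, hy]
    | tmul a b =>
      induction D with
      | zero => simp
      | add x y hx hy => simp only [map_add, add_mul, hx, hy]
      | tmul e f => simp [mix, antipode_mul_antidistrib, mul_assoc]
  rw [mul_assoc, ← J.contractRight_inv, key, J.contractMid_inv, h4]

/-- The coseparability identity for the two-sided twist `H^(L,J)`. -/
theorem IsLeftIntegralOn.pairRight_twistedComul (hl : IsLeftIntegralOn lam)
    (hc : ∀ y x : H, lam (y * x) = lam (x * antipode k (antipode k y))) (L : Twist k H)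
    (c d : H) :
    pairRight lam (L.Q * d) (twistedComul L J c * (1 ⊗ₜ J.Qinv)) =
      pairLeft lam (c * J.Qinv) ((L.Q ⊗ₜ 1) * twistedComul L J d) := by
  let σ : H ⊗[k] H →ₗ[k] H ⊗[k] H :=
    (TensorProduct.comm k H H).toLinearMap ∘ₗ (antipode k).lTensor H
  have key : ∀ Z : H ⊗[k] H, pairRight lam (L.Q * d)
      (Z * (comul c * (J.elt : H ⊗[k] H) * (1 ⊗ₜ J.Qinv))) =
      pairLeft lam (c * J.Qinv) (σ (contractMid k H ((comul (R := k)).lTensor H Z)) *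
        (comul (L.Q * d) * (J.elt : H ⊗[k] H))) := fun Z => by
    induction Z with
    | zero => simp
    | add x y hx hy => simp only [map_add, add_mul, hx, hy]
    | tmul l l' =>
      -- The twisted commutation rule moves `l'` to the far right as `S²(l')`, where it is absorbed
      -- into the argument of `S` as `S(l') Q_L d`.
      have h1 : ∀ U : H ⊗[k] H, pairRight lam (L.Q * d) ((l ⊗ₜ l') * U) =
          l * pairRight lam (antipode k l' * (L.Q * d)) U := fun U => by
        induction U with
        | zero => simp
        | add x y hx hy => simp only [map_add, mul_add, hx, hy]
        | tmul a b =>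
          simp only [Algebra.TensorProduct.tmul_mul_tmul, pairRight_tmul, mul_smul_comm,
            antipode_mul_antidistrib, mul_assoc]
          rw [hc l']
          simp only [mul_assoc]
      have h2 : ∀ (x : H) (v R : H ⊗[k] H), l * pairLeft lam x (antipodeSwap k H v * R) =
          pairLeft lam x (σ (contractMid k H (l ⊗ₜ v)) * R) := fun x v R => by
        induction v with
        | zero => simp
        | add x y hx hy => simp only [map_add, mul_add, add_mul, TensorProduct.tmul_add, hx, hy]
        | tmul p q =>
          induction R with
          | zero => simp
          | add x y hx hy => simp only [map_add, mul_add, hx, hy]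
          | tmul e f => simp [σ, mul_assoc]
      rw [h1, hl.pairRight_comul_twist, LinearMap.lTensor_tmul, ← h2, Bialgebra.comul_mul,
        comul_antipode, mul_assoc]
  have h3 : ∀ (q : H) (X : H ⊗[k] H), σ ((q ⊗ₜ 1) * (antipode k).rTensor H X) =
      (1 ⊗ₜ q) * antipodeSwap k H X := fun q X => by
    induction X with
    | zero => simp
    | add x y hx hy => simp only [map_add, mul_add, hx, hy]
    | tmul a b => simp [σ]
  rw [twistedComul_apply, mul_assoc, key, L.contractMid_inv, h3, Bialgebra.comul_mul]
  congr 1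
  -- What remains is `(1 ⊗ Q_L⁻¹)(Q_L ⊗ Q_L) L⁻¹ = (Q_L ⊗ 1) L⁻¹`.
  rw [mul_assoc, mul_assoc, ← mul_assoc (antipodeSwap k H _), L.antipodeSwap_mul_comul_Q,
    ← mul_assoc, ← mul_assoc, ← mul_assoc, Algebra.TensorProduct.tmul_mul_tmul, L.Qinv_mul_Q,
    one_mul, twistedComul_apply]
  simp only [mul_assoc]

/-- `lam(Q_L⁻¹ S(Q_L)) = lam(1)`. -/
theorem apply_Qinv_mul_antipode_Q
    (hc : ∀ y x : H, lam (y * x) = lam (x * antipode k (antipode k y))) :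
    lam (J.Qinv * antipode k J.Q) = lam 1 := by
  -- For `Y = a ⊗ b`: `λ(q S(S(a) b)) = λ(q S(b) S²(a)) = λ(a q S(b))`.
  have h : ∀ (q : H) (Y : H ⊗[k] H),
      lam (q * antipode k (LinearMap.mul' k H ((antipode k).rTensor H Y))) =
      lam (sandwich q Y) := fun q Y => by
    induction Y with
    | zero => simp
    | add x y hx hy => simp only [map_add, mul_add, hx, hy]
    | tmul a b => simp [antipode_mul_antidistrib, mul_assoc, hc a]
  rw [Twist.Q, h, J.sandwich_Qinv]

/-- Writing `S(g) S(Q_L)` as `S(Q_L g)` turns the pairing axioms into `h1` and `h2`, so the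
one-sided and two-sided cases share this reduction. -/
theorem isCoseparabilityPairing_twistedPairing (L : Twist k H)
    (h1 : ∀ c d : H, pairRight lam (L.Q * d) (twistedComul L J c * (1 ⊗ₜ J.Qinv)) =
      pairLeft lam (c * J.Qinv) ((L.Q ⊗ₜ 1) * twistedComul L J d))
    (h2 : lam (L.Qinv * antipode k L.Q) = 1) :
    IsCoseparabilityPairing k (twistedPairing L J lam) := by
  let ψ : H ⊗[k] H →ₗ[k] k := lam ∘ₗ LinearMap.mulRight k (antipode k L.Q) ∘ₗ
    LinearMap.mul' k H ∘ₗ TensorProduct.map (LinearMap.mulRight k J.Qinv) (antipode k (A := H))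
  refine ⟨fun (c d : H) => ?_, fun (c : H) => ?_⟩
  · have h3 : ∀ u : H ⊗[k] H, TensorProduct.rid k H (ψ.lTensor H
        (TensorProduct.assoc k H H H (u ⊗ₜ d))) =
        pairRight lam (L.Q * d) (u * (1 ⊗ₜ J.Qinv)) := fun u => by
      induction u with
      | zero => simp
      | add x y hx hy => simp only [map_add, add_mul, TensorProduct.add_tmul, hx, hy]
      | tmul a b => simp [ψ, antipode_mul_antidistrib, mul_assoc]
    have h4 : ∀ u : H ⊗[k] H, TensorProduct.lid k H (ψ.rTensor H
        ((TensorProduct.assoc k H H H).symm (c ⊗ₜ u))) =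
        pairLeft lam (c * J.Qinv) ((L.Q ⊗ₜ 1) * u) := fun u => by
      induction u with
      | zero => simp
      | add x y hx hy => simp only [map_add, mul_add, TensorProduct.tmul_add, hx, hy]
      | tmul a b => simp [ψ, antipode_mul_antidistrib, mul_assoc]
    exact (h3 (twistedComul L J c)).trans ((h1 c d).trans (h4 (twistedComul L J d)).symm)
  · change lam (sandwich J.Qinv (twistedComul L J c) * antipode k L.Q) = counit (R := k) c
    rw [sandwich_Qinv_twistedComul, smul_mul_assoc, map_smul, h2, smul_eq_mul, mul_one]

instance [FiniteDimensional k H] (L : Twist k H) :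
    FiniteDimensional k (TwistedCoalgebra L J) :=
  inferInstanceAs (FiniteDimensional k H)

theorem Twist.elt_one : ((1 : Twist k H).elt : H ⊗[k] H) = 1 := rfl

theorem Twist.Q_one : (1 : Twist k H).Q = 1 := by
  simp [Twist.Q, Twist.elt_one, Algebra.TensorProduct.one_def]

theorem Twist.elt_one_inv : (((1 : Twist k H).elt⁻¹ : (H ⊗[k] H)ˣ) : H ⊗[k] H) = 1 := by
  rw [show (1 : Twist k H).elt = 1 from rfl, inv_one, Units.val_one]

theorem Twist.Qinv_one : (1 : Twist k H).Qinv = 1 := by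
  simp [Twist.Qinv, Twist.elt_one_inv, Algebra.TensorProduct.one_def]

end Twists

end HopfTwist

theorem mainTheorem6 {k : Type*} [Field k] [IsAlgClosed k] {H : Type*} [Ring H]
    [HopfAlgebra k H] [FiniteDimensional k H] (hH : HopfTwist.IsCosemisimple k H) :
    (∃ lam : H →ₗ[k] k, HopfTwist.IsLeftIntegralOn lam ∧ lam 1 = 1) ∧
    (HopfTwist.IsUnimodular k H → ∀ L J : HopfTwist.Twist k H,
      HopfTwist.IsCosemisimple k (HopfTwist.TwistedCoalgebra L J) ∧
      ∀ lam : H →ₗ[k] k, HopfTwist.IsLeftIntegralOn lam → lam 1 = 1 →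
        HopfTwist.IsCoseparabilityPairing k (HopfTwist.twistedPairing L J lam)) ∧
    (∀ J : HopfTwist.Twist k H,
      HopfTwist.IsCosemisimple k (HopfTwist.TwistedCoalgebra 1 J) ∧
      ∀ lam : H →ₗ[k] k, HopfTwist.IsLeftIntegralOn lam → lam 1 = 1 →
        HopfTwist.IsCoseparabilityPairing k (HopfTwist.twistedPairing 1 J lam)) := by
  obtain ⟨lam₀, hl₀, hr₀, h1₀⟩ := HopfTwist.exists_twoSided_integral k H hH
  have hl₀ : HopfTwist.IsLeftIntegralOn lam₀ := hl₀
  have two : HopfTwist.IsUnimodular k H → ∀ (L J : HopfTwist.Twist k H) (lam : H →ₗ[k] k),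
      HopfTwist.IsLeftIntegralOn lam → lam 1 = 1 →
        HopfTwist.IsCoseparabilityPairing k (HopfTwist.twistedPairing L J lam) := by
    intro hu L J lam hl h1
    -- Uniqueness supplies the right invariance that `apply_mul_comm` requires of `lam`.
    obtain rfl := HopfTwist.left_integral_eq_right_integral hl h1 hr₀ h1₀
    have hc := hl.apply_mul_comm hr₀ h1 hu
    exact HopfTwist.isCoseparabilityPairing_twistedPairing J L
      (hl.pairRight_twistedComul J hc L)
      ((HopfTwist.apply_Qinv_mul_antipode_Q L hc).trans h1)
  have one : ∀ (J : HopfTwist.Twist k H) (lam : H →ₗ[k] k),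
      HopfTwist.IsLeftIntegralOn lam → lam 1 = 1 →
        HopfTwist.IsCoseparabilityPairing k (HopfTwist.twistedPairing 1 J lam) := by
    intro J lam hl h1
    refine HopfTwist.isCoseparabilityPairing_twistedPairing J 1 (fun c d => ?_) ?_
    · rw [HopfTwist.Twist.Q_one, HopfTwist.twistedComul_apply, HopfTwist.twistedComul_apply,
        HopfTwist.Twist.elt_one_inv, one_mul, one_mul, one_mul,
        ← Algebra.TensorProduct.one_def, one_mul]
      exact hl.pairRight_comul_twist J c d
    · rw [HopfTwist.Twist.Q_one, HopfTwist.Twist.Qinv_one, HopfAlgebra.antipode_one, mul_one, h1]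
  exact ⟨⟨lam₀, hl₀, h1₀⟩,
    fun hu L J => ⟨(two hu L J lam₀ hl₀ h1₀).isCosemisimple, two hu L J⟩,
    fun J => ⟨(one J lam₀ hl₀ h1₀).isCosemisimple, one J⟩⟩
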